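/- Let $d\ge 1$ and let $H_\omega=-\Delta+V_\omega$ be the Anderson Hamiltonian on $\ell^2(\mathbb Z^d)$, where $(\Delta\varphi)(x)=-\sum_{|x-y|=1}\varphi(y)$ and $\{V_\omega(x)\}_{x\in\mathbb Z^d}$ are independent, identically distributed real random variables on a probability space $(\Omega,\mathbb P)$ whose common law has compact support and a bounded density. Let $\mathbb Z^d$ act on $\Omega$ by measure preserving maps $\tau_a$ with $V_{\tau_a\omega}(x)=V_\omega(x-a)$. Let $\delta_a$ be the canonical basis of $\ell^2(\mathbb Z^d)$ and $(U(a)\varphi)(x)=\varphi(x-a)$. Let $\mathcal K_2$ be the Hilbert space of measurable covariant operators $A$ (measurable families $A_\omega$ of operators, defined on the finitely supported functions with values in $\ell^2(\mathbb Z^d)$, with $U(a)A_\omega U(a)^*=A_{\tau_a\omega}$ almost surely, identified if they agree almost surely) such that $\mathbb E\|A_\omega\delta_0\|^2<\infty$, with inner product $\langle\!\langle A,B\rangle\!\rangle=\mathbb E\langle A_\omega\delta_0,B_\omega\delta_0\rangle$. On $\mathcal K_2$ let $(\mathcal H_LA)_\omega=H_\omega A_\omega$, $(\mathcal H_RA)_\omega=A_\omega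 H_\omega$, $\mathcal L=\mathcal H_L-\mathcal H_R$, and let $\mathcal L_\perp^{-1}=g(\mathcal L)$, where $g(t)=1/t$ for $t\ne0$ and $g(0)=0$. Let $X_1$ be multiplication by the first coordinate, $\dot X_1=i[H,X_1]$, and for $T>0$, $\mu\in\mathbb R$ put $$f_\mu^T(E)=\frac1{e^{(E-\mu)/T}+1},\qquad Y_\mu^T=i[X_1,f_\mu^T(H)],\qquad \mathcal F_\mu^T=f_\mu^T(\mathcal H_L)-f_\mu^T(\mathcal H_R).$$ For Borel sets $B\subset\mathbb R$ define the conductivity measure $\Sigma_\mu^T$ and the measure $\Gamma_\mu^T$ by $$\Sigma_\mu^T(B)=\pi\langle\!\langle\dot X_1,\chi_B(\mathcal L)Y_\mu^T\rangle\!\rangle,\qquad \Gamma_\mu^T(B)=\pi\big\langle\!\big\langle(-\mathcal L_\perp^{-1}\mathcal F_\mu^T)^{1/2}\dot X_1,\chi_B(\mathcal L)(-\mathcal L_\perp^{-1}\mathcal F_\mu^T)^{1/2}\dot X_1\big\rangle\!\big\rangle .$$ Theorem. For every $T>0$ and $\mu\in\mathbb R$, $\Sigma_\mu^T$ and $\Gamma_\mu^T$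 are finite positive Borel measures on $\mathbb R$, and they are nontrivial: $$\Sigma_\mu^T(\mathbb R)\ \ge\ \Gamma_\mu^T(\mathbb R)\ >\ 0 .$$ Moreover, for every $\mu\in\mathbb R$, $\Sigma_\mu^T\to0$ and $\Gamma_\mu^T\to0$ strongly as $T\to\infty$, that is, $\lim_{T\to\infty}\Sigma_\mu^T(B)=\lim_{T\to\infty}\Gamma_\mu^T(B)=0$ for every Borel set $B\subset\mathbb R$. -/

import Mathlib

open MeasureTheory Filter Topology ProbabilityTheory
open scoped CompactlySupported ENNReal NNReal

namespace Anderson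

section BorelCalculus
variable {K : Type*} [NormedAddCommGroup K] [InnerProductSpace ℂ K] [CompleteSpace K]

/-- The continuous functional calculus `f(A)` of a self-adjoint bounded operator `A`, for a real
function `f` which is continuous on the spectrum of `A`. -/
noncomputable def functionOf (f : ℝ → ℝ) (A : K →L[ℂ] K) : K →L[ℂ] K := cfc f A

/-- For a self-adjoint bounded operator `A` and a vector `x`, the positive linear functional
`f ↦ ⟨x, f(A) x⟩` on `C_c(ℝ)`, where `f(A)` is the continuous functional calculus. -/
noncomputable def spectralFunctional (A : K →L[ℂ] K) (x : K) : C_c(ℝ, ℝ) →ₚ[ℝ] ℝ :=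
  PositiveLinearMap.mk₀
    { toFun := fun f => RCLike.re (inner ℂ x (cfc (fun t : ℝ => f t) A x))
      map_add' := by
        intro f g
        have hf := f.continuous
        have hg := g.continuous
        have : cfc (fun t : ℝ => (f + g) t) A
            = cfc (fun t : ℝ => f t) A + cfc (fun t : ℝ => g t) A :=
          cfc_add (a := A) (fun t : ℝ => f t) (fun t : ℝ => g t)
        rw [this, add_apply, inner_add_right, map_add]
      map_smul' := by
        intro r f
        have hf := f.continuous
        have : cfc (fun t : ℝ => (r • f) t) A = r • cfc (fun t : ℝ => f t) A :=
          cfc_smul (a := A) r (fun t : ℝ => f t)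
        rw [this, smul_apply, inner_smul_right_eq_smul]
        simp }
    (by
      intro f hf
      have h : 0 ≤ cfc (fun t : ℝ => f t) A := cfc_nonneg fun t _ => hf t
      have := ((ContinuousLinearMap.nonneg_iff_isPositive _).1 h).re_inner_nonneg_right x
      exact this)

/-- The spectral measure `μ_x` of a self-adjoint bounded operator `A` at the vector `x`:
the regular Borel measure with `∫ f dμ_x = ⟨x, f(A) x⟩` for all `f ∈ C_c(ℝ)`. -/
noncomputable def spectralMeasure (A : K →L[ℂ] K) (x : K) : Measure ℝ :=
  RealRMK.rieszMeasure (spectralFunctional A x)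

instance (A : K →L[ℂ] K) (x : K) : (spectralMeasure A x).Regular :=
  RealRMK.regular_rieszMeasure _

/-- `IsBorelApply A g x z` says that `x` is in the domain of `g(A)` and `g(A) x = z`: one has
`g ∈ L²(μ_x)`, and `z` is the image of `g` under the isometry `L²(μ_x) → K` which extends
`f ↦ f(A) x`, `f ∈ C_c(ℝ)`. -/
def IsBorelApply (A : K →L[ℂ] K) (g : ℝ → ℝ) (x z : K) : Prop :=
  MemLp g 2 (spectralMeasure A x) ∧ ∀ ε : ℝ, 0 < ε → ∃ f : C_c(ℝ, ℝ),
    eLpNorm (fun t => g t - f t) 2 (spectralMeasure A x) ≤ ENNReal.ofReal ε ∧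
      ‖cfc (fun t : ℝ => f t) A x - z‖ ≤ ε

theorem integral_spectralMeasure (A : K →L[ℂ] K) (x : K) (f : C_c(ℝ, ℝ)) :
    ∫ t, f t ∂(spectralMeasure A x) = RCLike.re (inner ℂ x (cfc (fun t : ℝ => f t) A x)) :=
  RealRMK.integral_rieszMeasure _ f

theorem eLpNorm_spectralMeasure {A : K →L[ℂ] K} (x : K) (f : C_c(ℝ, ℝ)) :
    eLpNorm (fun t => f t) 2 (spectralMeasure A x)
      = ENNReal.ofReal ‖cfc (fun t : ℝ => f t) A x‖ := by
  have hf := f.continuous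
  have hm : MemLp (fun t => f t) 2 (spectralMeasure A x) :=
    hf.memLp_of_hasCompactSupport f.hasCompactSupport
  have h1 : ∫ t, ‖f t‖ ^ 2 ∂(spectralMeasure A x) = ‖cfc (fun t : ℝ => f t) A x‖ ^ 2 := by
    have := integral_spectralMeasure A x (f * f)
    have e1 : cfc (fun t : ℝ => (f * f) t) A
        = cfc (fun t : ℝ => f t) A * cfc (fun t : ℝ => f t) A :=
      cfc_mul (a := A) (fun t : ℝ => f t) (fun t : ℝ => f t)
    have e2 : IsSelfAdjoint (cfc (fun t : ℝ => f t) A) := cfc_predicate _ _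
    have e3 := (ContinuousLinearMap.isSelfAdjoint_iff_isSymmetric.1 e2) x (cfc (fun t : ℝ => f t) A x)
    rw [e1, mul_apply_eq_comp] at this
    have e4 : inner ℂ x (cfc (fun t : ℝ => f t) A (cfc (fun t : ℝ => f t) A x))
       = inner ℂ (cfc (fun t : ℝ => f t) A x) (cfc (fun t : ℝ => f t) A x) := e3.symm
    rw [e4, inner_self_eq_norm_sq] at this
    rw [← this]
    congr 1
    ext t
    simp [sq]
  have := hm.eLpNorm_eq_integral_rpow_norm (by norm_num) (by norm_num)
  rw [this]
  congr 1
  simp only [ENNReal.toReal_ofNat, Real.rpow_ofNat]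
  rw [h1, ← Real.rpow_natCast, ← Real.rpow_mul (norm_nonneg _)]
  simp

theorem norm_cfc_sub_le {A : K →L[ℂ] K} {g : ℝ → ℝ} {x : K}
    (hg : AEStronglyMeasurable g (spectralMeasure A x)) {f f' : C_c(ℝ, ℝ)} {ε ε' : ℝ}
    (h0 : 0 ≤ ε) (h0' : 0 ≤ ε')
    (h : eLpNorm (fun t => g t - f t) 2 (spectralMeasure A x) ≤ ENNReal.ofReal ε)
    (h' : eLpNorm (fun t => g t - f' t) 2 (spectralMeasure A x) ≤ ENNReal.ofReal ε') :
    ‖cfc (fun t : ℝ => f t) A x - cfc (fun t : ℝ => f' t) A x‖ ≤ ε + ε' := by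
  have hf := f.continuous
  have hf' := f'.continuous
  have e : cfc (fun t : ℝ => f t) A x - cfc (fun t : ℝ => f' t) A x
      = cfc (fun t : ℝ => (f - f') t) A x := by
    have : cfc (fun t : ℝ => (f - f') t) A
        = cfc (fun t : ℝ => f t) A - cfc (fun t : ℝ => f' t) A :=
      cfc_sub (a := A) (fun t : ℝ => f t) (fun t : ℝ => f' t)
    rw [this, sub_apply]
  rw [e, ← ENNReal.ofReal_le_ofReal_iff (by positivity), ← eLpNorm_spectralMeasure,
    ENNReal.ofReal_add h0 h0']
  have e2 : (fun t => (f - f') t) = (fun t => g t - f' t) - (fun t => g t - f t) := by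
    ext t; simp
  rw [e2]
  calc _ ≤ _ := eLpNorm_sub_le (hg.sub hf'.aestronglyMeasurable)
            (hg.sub hf.aestronglyMeasurable) (by norm_num)
    _ ≤ _ := by rw [add_comm]; exact add_le_add h h'

theorem IsBorelApply.unique {A : K →L[ℂ] K} {g : ℝ → ℝ} {x z w : K}
    (hz : IsBorelApply A g x z) (hw : IsBorelApply A g x w) : z = w := by
  have key : ∀ ε : ℝ, 0 < ε → dist z w ≤ ε := by
    intro ε hε
    obtain ⟨f, hf, hfz⟩ := hz.2 (ε / 4) (by positivity)
    obtain ⟨f', hf', hfw⟩ := hw.2 (ε / 4) (by positivity)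
    have h := norm_cfc_sub_le hz.1.1 (by positivity) (by positivity) hf hf'
    rw [← dist_eq_norm] at h hfz hfw
    have h1 := dist_triangle4 z (cfc (fun t : ℝ => f t) A x) (cfc (fun t : ℝ => f' t) A x) w
    rw [dist_comm z (cfc (fun t : ℝ => f t) A x)] at h1
    linarith
  exact dist_le_zero.1 (le_of_forall_pos_le_add fun ε hε => by simpa using key ε hε)

/-- The domain of `g(A)` is exactly `{x | g ∈ L²(μ_x)}`. -/
theorem exists_isBorelApply {A : K →L[ℂ] K} {g : ℝ → ℝ} {x : K}
    (hg : MemLp g 2 (spectralMeasure A x)) : ∃ z, IsBorelApply A g x z := by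
  have hex : ∀ n : ℕ, ∃ f : C_c(ℝ, ℝ), eLpNorm (fun t => g t - f t) 2 (spectralMeasure A x)
      ≤ ENNReal.ofReal ((1 / 2 : ℝ) ^ n) := by
    intro n
    obtain ⟨f, h1, h2, h3, -⟩ := hg.exists_hasCompactSupport_eLpNorm_sub_le (by norm_num)
      (ε := ENNReal.ofReal ((1 / 2 : ℝ) ^ n)) (by simp)
    exact ⟨⟨⟨f, h3⟩, h1⟩, h2⟩
  choose f hf using hex
  have hd : ∀ n m, ‖cfc (fun t : ℝ => f n t) A x - cfc (fun t : ℝ => f m t) A x‖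
      ≤ (1 / 2 : ℝ) ^ n + (1 / 2 : ℝ) ^ m := fun n m =>
    norm_cfc_sub_le hg.1 (by positivity) (by positivity) (hf n) (hf m)
  have ht : Tendsto (fun n : ℕ => (1 / 2 : ℝ) ^ n) atTop (𝓝 0) :=
    tendsto_pow_atTop_nhds_zero_of_lt_one (by norm_num) (by norm_num)
  have hc : CauchySeq fun n => cfc (fun t : ℝ => f n t) A x := by
    refine cauchySeq_of_le_tendsto_0 (fun N => (1 / 2 : ℝ) ^ N + (1 / 2 : ℝ) ^ N) ?_
      (by simpa using ht.add ht)
    intro n m N hn hm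
    rw [dist_eq_norm]
    refine (hd n m).trans (add_le_add ?_ ?_) <;>
      exact pow_le_pow_of_le_one (by norm_num) (by norm_num) (by assumption)
  obtain ⟨z, hz⟩ := cauchySeq_tendsto_of_complete hc
  refine ⟨z, hg, fun ε hε => ?_⟩
  have h1 := (tendsto_order.1 ht).2 ε hε
  have h2 := (Metric.tendsto_nhds.1 hz) ε hε
  obtain ⟨n, hn1, hn2⟩ := (h1.and h2).exists
  rw [dist_eq_norm] at hn2
  exact ⟨f n, (hf n).trans (ENNReal.ofReal_le_ofReal hn1.le), hn2.le⟩

open Classical in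
/-- The Borel functional calculus of a self-adjoint bounded operator `A`: the vector `g(A) x`
for `x` in the domain `{x | g ∈ L²(μ_x)}` of `g(A)` (all of `K` if `g` is bounded), and the
default value `0` off that domain. -/
noncomputable def borelApply (A : K →L[ℂ] K) (g : ℝ → ℝ) (x : K) : K :=
  if h : ∃ z, IsBorelApply A g x z then h.choose else 0

/-- The spectral projection `χ_B(A)`, applied to `x`. -/
noncomputable def spectralProjection (A : K →L[ℂ] K) (B : Set ℝ) (x : K) : K :=
  borelApply A (B.indicator fun _ => 1) x

end BorelCalculus
/-- The lattice `ℤ^d`. -/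
abbrev Lattice (d : ℕ) : Type := Fin d → ℤ

/-- The Hilbert space `ℓ²(ℤ^d)`. -/
abbrev L2 (d : ℕ) : Type := lp (fun _ : Lattice d => ℂ) 2

/-- The dense subspace of finitely supported functions on `ℤ^d`. -/
abbrev Fin2 (d : ℕ) : Type := Lattice d →₀ ℂ

section Lattice
variable {d : ℕ}

/-- The canonical basis vector `δ_a` of `ℓ²(ℤ^d)`. -/
noncomputable def delta (a : Lattice d) : L2 d := lp.single 2 a 1

/-- The inclusion of the finitely supported functions in `ℓ²(ℤ^d)`. -/
noncomputable def incl : Fin2 d →ₗ[ℂ] L2 d := Finsupp.linearCombination ℂ delta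

theorem memℓp_shift (a : Lattice d) (φ : L2 d) : Memℓp (fun x => φ (x - a)) 2 := by
  have h := (lp.memℓp φ).summable (by norm_num)
  exact memℓp_gen ((Equiv.subRight a).summable_iff.2 h)

theorem norm_shift (a : Lattice d) (φ : L2 d) :
    ‖(⟨fun x => φ (x - a), memℓp_shift a φ⟩ : L2 d)‖ = ‖φ‖ := by
  rw [lp.norm_eq_tsum_rpow (by norm_num), lp.norm_eq_tsum_rpow (by norm_num)]
  congr 1
  exact (Equiv.subRight a).tsum_eq (fun x => ‖φ x‖ ^ (2 : ℝ≥0∞).toReal)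

/-- The unitary translation `(U(a)φ)(x) = φ(x - a)` on `ℓ²(ℤ^d)`. -/
noncomputable def shift (a : Lattice d) : L2 d →L[ℂ] L2 d :=
  LinearMap.mkContinuous
    { toFun := fun φ => ⟨fun x => φ (x - a), memℓp_shift a φ⟩
      map_add' := fun _ _ => rfl
      map_smul' := fun _ _ => rfl } 1 (fun φ => by
        rw [one_mul]; exact (norm_shift a φ).le)

theorem shift_apply (a : Lattice d) (φ : L2 d) (x : Lattice d) :
    shift a φ x = φ (x - a) := rfl

theorem norm_shift_apply (a : Lattice d) (φ : L2 d) : ‖shift a φ‖ = ‖φ‖ := norm_shift a φ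

theorem shift_shift (a b : Lattice d) (φ : L2 d) : shift a (shift b φ) = shift (a + b) φ := by
  ext x
  simp only [shift_apply]
  rw [sub_sub]

/-- Translation by `a` on the finitely supported functions. -/
noncomputable def shiftFin (a : Lattice d) : Fin2 d →ₗ[ℂ] Fin2 d :=
  Finsupp.lmapDomain ℂ ℂ (fun x => x + a)

/-- The centered discrete Laplacian `(Δφ)(x) = - ∑_{|x-y|=1} φ(y)` on `ℓ²(ℤ^d)`; the neighbours of
`x` are the points `x ± e_j`. -/
noncomputable def laplacian : L2 d →L[ℂ] L2 d :=
  -∑ j : Fin d, (shift (Pi.single j 1) + shift (-Pi.single j 1))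

/-- The discrete Laplacian on the finitely supported functions. -/
noncomputable def laplacianFin : Fin2 d →ₗ[ℂ] Fin2 d :=
  -∑ j : Fin d, (shiftFin (Pi.single j 1) + shiftFin (-Pi.single j 1))

theorem memℓp_mul {v : Lattice d → ℝ} {C : ℝ} (h : ∀ x, |v x| ≤ C) (φ : L2 d) :
    Memℓp (fun x => (v x : ℂ) * φ x) 2 := by
  refine ((lp.memℓp φ).const_smul (C : ℂ)).mono' fun x => ?_
  rw [Pi.smul_apply, norm_mul, norm_smul, Complex.norm_real, Complex.norm_real, Real.norm_eq_abs,
    Real.norm_eq_abs]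
  exact mul_le_mul_of_nonneg_right ((h x).trans (le_abs_self C)) (norm_nonneg _)

theorem norm_mul_le {v : Lattice d → ℝ} {C : ℝ} (h : ∀ x, |v x| ≤ C) (φ : L2 d) :
    ‖(⟨fun x => (v x : ℂ) * φ x, memℓp_mul h φ⟩ : L2 d)‖ ≤ C * ‖φ‖ := by
  have h0 : 0 ≤ C := (abs_nonneg _).trans (h 0)
  have e : C * ‖φ‖ = ‖(C : ℂ) • φ‖ := by
    rw [norm_smul, Complex.norm_real, Real.norm_eq_abs, abs_of_nonneg h0]
  rw [e]
  refine lp.norm_mono (by norm_num) fun x => ?_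
  rw [lp.coeFn_smul, Pi.smul_apply, norm_smul, norm_mul, Complex.norm_real, Complex.norm_real,
    Real.norm_eq_abs, Real.norm_eq_abs]
  exact mul_le_mul_of_nonneg_right ((h x).trans (le_abs_self C)) (norm_nonneg _)

open Classical in
/-- Multiplication by a bounded real function `v` on `ℓ²(ℤ^d)` (and `0` if `v` is unbounded). -/
noncomputable def mulOp (v : Lattice d → ℝ) : L2 d →L[ℂ] L2 d :=
  if h : ∃ C, ∀ x, |v x| ≤ C then
    LinearMap.mkContinuous
      { toFun := fun φ => ⟨fun x => (v x : ℂ) * φ x, memℓp_mul h.choose_spec φ⟩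
        map_add' := fun φ ψ => by ext x; exact mul_add _ _ _
        map_smul' := fun c φ => by ext x; exact mul_left_comm _ _ _ } h.choose (fun φ =>
          norm_mul_le h.choose_spec φ)
  else 0

theorem mulOp_apply {v : Lattice d → ℝ} (h : ∃ C, ∀ x, |v x| ≤ C) (φ : L2 d) (x : Lattice d) :
    mulOp v φ x = v x * φ x := by
  rw [mulOp, dif_pos h]
  rfl

theorem norm_mulOp_apply_le {v : Lattice d → ℝ} {C : ℝ} (h : ∀ x, |v x| ≤ C) (φ : L2 d) :
    ‖mulOp v φ‖ ≤ C * ‖φ‖ := by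
  have h' : ∃ C, ∀ x, |v x| ≤ C := ⟨C, h⟩
  rw [mulOp, dif_pos h']
  exact norm_mul_le h φ

theorem mulOp_shift {v : Lattice d → ℝ} (a : Lattice d) (φ : L2 d) :
    mulOp (fun x => v (x - a)) (shift a φ) = shift a (mulOp v φ) := by
  by_cases h : ∃ C, ∀ x, |v x| ≤ C
  · have h' : ∃ C, ∀ x, |v (x - a)| ≤ C := h.imp fun C hC x => hC _
    ext x
    rw [mulOp_apply h', shift_apply, shift_apply, mulOp_apply h]
  · have h' : ¬ ∃ C, ∀ x, |v (x - a)| ≤ C := fun ⟨C, hC⟩ =>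
      h ⟨C, fun x => by simpa using hC (x + a)⟩
    rw [mulOp, mulOp, dif_neg h, dif_neg h']
    simp

/-- Multiplication by an arbitrary function `v` on the finitely supported functions. -/
noncomputable def mulFin (v : Lattice d → ℝ) : Fin2 d →ₗ[ℂ] Fin2 d :=
  Finsupp.linearCombination ℂ (fun x => Finsupp.single x (v x : ℂ))

theorem mulFin_single (v : Lattice d → ℝ) (a : Lattice d) (c : ℂ) :
    mulFin v (Finsupp.single a c) = Finsupp.single a (v a * c) := by
  rw [mulFin, Finsupp.linearCombination_single, Finsupp.smul_single, smul_eq_mul, mul_comm]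

theorem incl_single (a : Lattice d) (c : ℂ) : incl (Finsupp.single a c) = c • delta a := by
  rw [incl, Finsupp.linearCombination_single]

/-- A map into `ℓ²(ℤ^d)` with measurable coordinates is measurable. -/
theorem aestronglyMeasurable_of_coord {Ω : Type*} [MeasurableSpace Ω] {P : Measure Ω}
    {f : Ω → L2 d} (h : ∀ x, AEStronglyMeasurable (fun ω => f ω x) P) :
    AEStronglyMeasurable f P := by
  refine aestronglyMeasurable_of_tendsto_ae (u := (atTop : Filter (Finset (Lattice d))))
    (f := fun s ω => ∑ x ∈ s, lp.single 2 x (f ω x)) (fun s => ?_) (ae_of_all _ fun ω => ?_)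
  · refine Finset.aestronglyMeasurable_fun_sum s fun x _ => ?_
    exact (lp.singleContinuousLinearMap ℂ (fun _ : Lattice d => ℂ) 2
      x).continuous.comp_aestronglyMeasurable (h x)
  · exact lp.hasSum_single (by norm_num) (f ω)

theorem shiftFin_single (a b : Lattice d) (c : ℂ) :
    shiftFin a (Finsupp.single b c) = Finsupp.single (b + a) c := by
  simp [shiftFin]

theorem shiftFin_shiftFin (a b : Lattice d) (φ : Fin2 d) :
    shiftFin a (shiftFin b φ) = shiftFin (a + b) φ := by
  induction φ using Finsupp.induction_linear with
  | zero => simp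
  | add f g hf hg => simp [hf, hg]
  | single x c => simp only [shiftFin_single]; congr 1; abel

theorem mulFin_shiftFin (v : Lattice d → ℝ) (a : Lattice d) (φ : Fin2 d) :
    mulFin (fun x => v (x - a)) (shiftFin a φ) = shiftFin a (mulFin v φ) := by
  induction φ using Finsupp.induction_linear with
  | zero => simp
  | add f g hf hg => simp [hf, hg]
  | single x c => simp [mulFin_single, shiftFin_single, -Finsupp.single_mul]

theorem laplacian_shift (a : Lattice d) (φ : L2 d) :
    laplacian (shift a φ) = shift a (laplacian φ) := by
  simp [laplacian, shift_shift, add_comm]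

theorem laplacianFin_shiftFin (a : Lattice d) (φ : Fin2 d) :
    laplacianFin (shiftFin a φ) = shiftFin a (laplacianFin φ) := by
  simp [laplacianFin, shiftFin_shiftFin, add_comm]

end Lattice

/-- The probabilistic data of the Anderson model: an i.i.d. random potential
`{V_ω(x)}_{x ∈ ℤ^d}` on the probability space `(Ω, P)`, whose single site distribution `ξ` has
compact support and a bounded density, together with the measure preserving action `τ` of `ℤ^d`
on `Ω` under which the potential is covariant. (For the canonical space `Ω = ℝ^{ℤ^d}` with
`V_ω(x) = ω(x)` and the product measure, `τ` is the translation of configurations.) -/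
structure AndersonModel (d : ℕ) (Ω : Type*) [MeasurableSpace Ω] (P : Measure Ω) where
  /-- the random potential -/
  V : Ω → Lattice d → ℝ
  measurable_V : ∀ x, Measurable fun ω => V ω x
  indep : iIndepFun (fun (x : Lattice d) (ω : Ω) => V ω x) P
  /-- the single site probability distribution -/
  ξ : Measure ℝ
  law : ∀ x, P.map (fun ω => V ω x) = ξ
  compact_support : IsCompact ξ.support
  bounded_density : ∃ ρ : ℝ → ℝ≥0, Measurable ρ ∧ (∃ C, ∀ t, ρ t ≤ C) ∧
    ξ = volume.withDensity fun t => (ρ t : ℝ≥0∞)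
  /-- the action of `ℤ^d` on `Ω` -/
  τ : Lattice d → Ω → Ω
  τ_zero : ∀ ω, τ 0 ω = ω
  τ_add : ∀ a b ω, τ (a + b) ω = τ a (τ b ω)
  measurePreserving_τ : ∀ a, MeasurePreserving (τ a) P P
  covariant_V : ∀ a ω x, V (τ a ω) x = V ω (x - a)

namespace AndersonModel
variable {d : ℕ} {Ω : Type*} [MeasurableSpace Ω] {P : Measure Ω} (M : AndersonModel d Ω P)

/-- The Anderson Hamiltonian `H_ω = -Δ + V_ω`, a bounded operator on `ℓ²(ℤ^d)`. -/
noncomputable def ham (ω : Ω) : L2 d →L[ℂ] L2 d := -laplacian + mulOp (M.V ω)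

/-- The restriction of `H_ω` to the finitely supported functions. -/
noncomputable def hamFin (ω : Ω) : Fin2 d →ₗ[ℂ] Fin2 d := -laplacianFin + mulFin (M.V ω)

theorem exists_bound : ∃ C : ℝ, 0 ≤ C ∧ ∀ᵐ ω ∂P, ∀ x, |M.V ω x| ≤ C := by
  obtain ⟨C, hC⟩ := M.compact_support.isBounded.exists_norm_le
  refine ⟨max C 0, le_max_right _ _, ae_all_iff.2 fun x => ?_⟩
  have h : M.ξ.support ∈ ae M.ξ := Measure.support_mem_ae
  rw [← M.law x] at h
  have := ae_of_ae_map (M.measurable_V x).aemeasurable h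
  filter_upwards [this] with ω hω
  rw [M.law x] at hω
  exact (hC _ hω).trans (le_max_left _ _)

theorem ham_covariant (a : Lattice d) (ω : Ω) (φ : L2 d) :
    M.ham (M.τ a ω) (shift a φ) = shift a (M.ham ω φ) := by
  have : M.V (M.τ a ω) = fun x => M.V ω (x - a) := funext (M.covariant_V a ω)
  simp [ham, this, mulOp_shift, laplacian_shift]

theorem hamFin_covariant (a : Lattice d) (ω : Ω) (φ : Fin2 d) :
    M.hamFin (M.τ a ω) (shiftFin a φ) = shiftFin a (M.hamFin ω φ) := by
  have : M.V (M.τ a ω) = fun x => M.V ω (x - a) := funext (M.covariant_V a ω)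
  simp [hamFin, this, mulFin_shiftFin, laplacianFin_shiftFin]

theorem ham_incl {ω : Ω} (h : ∃ C, ∀ x, |M.V ω x| ≤ C) (φ : Fin2 d) :
    M.ham ω (incl φ) = incl (M.hamFin ω φ) := by
  have e : ∀ (a b : Lattice d), shift a (delta b) = delta (b + a) := by
    intro a b
    ext x
    simp [shift_apply, delta, lp.single_apply, Pi.single_apply, sub_eq_iff_eq_add]
  have e2 : ∀ b : Lattice d, mulOp (M.V ω) (delta b) = (M.V ω b : ℂ) • delta b := by
    intro b
    ext x
    rw [mulOp_apply h]
    by_cases hx : x = b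
    · subst hx; simp [delta, lp.coeFn_smul, -Complex.coe_smul]
    · simp [delta, lp.coeFn_smul, lp.single_apply, hx, -Complex.coe_smul]
  induction φ using Finsupp.induction_linear with
  | zero => simp
  | add f g hf hg => simp [hf, hg]
  | single x c =>
    simp [ham, hamFin, laplacian, laplacianFin, shiftFin_single, e, e2, mulFin_single,
      incl_single, Finset.smul_sum, smul_add, mul_smul, smul_comm c,
      -Complex.coe_smul, -Finsupp.single_mul]

/-- The measurable covariant operators of finite Hilbert-Schmidt type: families
`A_ω : (finitely supported functions) → ℓ²(ℤ^d)` such that `ω ↦ A_ω δ_a` is measurable,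
`U(a) A_ω U(a)^* = A_{τ_a ω}` almost surely, and `E ‖A_ω δ_0‖² < ∞`. -/
def covariantOperators : Submodule ℂ (Ω → (Fin2 d →ₗ[ℂ] L2 d)) where
  carrier := {A |
    (∀ a, AEStronglyMeasurable (fun ω => A ω (Finsupp.single a 1)) P) ∧
    (∀ a, ∀ᵐ ω ∂P, ∀ φ, A (M.τ a ω) (shiftFin a φ) = shift a (A ω φ)) ∧
    MemLp (fun ω => A ω (Finsupp.single 0 1)) 2 P}
  zero_mem' := by
    refine ⟨fun a => ?_, fun a => ?_, ?_⟩
    · exact aestronglyMeasurable_const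
    · simp
    · exact MemLp.zero'
  add_mem' := by
    rintro A B ⟨hA1, hA2, hA3⟩ ⟨hB1, hB2, hB3⟩
    refine ⟨fun a => (hA1 a).add (hB1 a), fun a => ?_, hA3.add hB3⟩
    filter_upwards [hA2 a, hB2 a] with ω h1 h2 φ
    simp [h1, h2]
  smul_mem' := by
    rintro c A ⟨hA1, hA2, hA3⟩
    refine ⟨fun a => (hA1 a).const_smul c, fun a => ?_, hA3.const_smul c⟩
    filter_upwards [hA2 a] with ω h1 φ
    simp [h1]

/-- The space of measurable covariant operators with `E ‖A_ω δ_0‖² < ∞`, before identifying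
operators which agree almost surely. -/
def PreK2 : Type _ := M.covariantOperators

noncomputable instance : AddCommGroup M.PreK2 :=
  inferInstanceAs (AddCommGroup M.covariantOperators)

noncomputable instance : Module ℂ M.PreK2 :=
  inferInstanceAs (Module ℂ M.covariantOperators)

variable {M} in
/-- The column `ω ↦ A_ω δ_0` as an element of `L²(Ω; ℓ²(ℤ^d))`. -/
noncomputable def column : M.PreK2 →ₗ[ℂ] Lp (L2 d) 2 P where
  toFun A := A.2.2.2.toLp
  map_add' A B := MemLp.toLp_add A.2.2.2 B.2.2.2
  map_smul' c A := MemLp.toLp_const_smul c A.2.2.2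

noncomputable instance : SeminormedAddCommGroup M.PreK2 :=
  SeminormedAddCommGroup.induced _ _ (column (M := M))

theorem inner_column (A B : M.PreK2) : inner ℂ (column A) (column B) =
    ∫ ω, inner ℂ (A.1 ω (Finsupp.single 0 1)) (B.1 ω (Finsupp.single 0 1)) ∂P := by
  rw [L2.inner_def]
  refine integral_congr_ae ?_
  filter_upwards [A.2.2.2.coeFn_toLp, B.2.2.2.coeFn_toLp] with ω h1 h2
  change inner ℂ (A.2.2.2.toLp _ ω) (B.2.2.2.toLp _ ω) = _
  rw [h1, h2]

/-- The inner product `⟪A, B⟫ = E ⟨A_ω δ_0, B_ω δ_0⟩`. -/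
noncomputable instance : InnerProductSpace ℂ M.PreK2 where
  norm_smul_le c A := by
    change ‖column (c • A)‖ ≤ ‖c‖ * ‖column A‖
    rw [map_smul, norm_smul]
  inner A B := ∫ ω, inner ℂ (A.1 ω (Finsupp.single 0 1)) (B.1 ω (Finsupp.single 0 1)) ∂P
  norm_sq_eq_re_inner A := by
    have h := norm_sq_eq_re_inner (𝕜 := ℂ) (column A)
    rw [inner_column] at h
    exact h
  conj_inner_symm A B := by
    rw [← inner_column, ← inner_column]
    exact inner_conj_symm _ _
  add_left A B C := by
    rw [← inner_column, ← inner_column, ← inner_column, map_add]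
    exact inner_add_left _ _ _
  smul_left A B c := by
    rw [← inner_column, ← inner_column, map_smul]
    exact inner_smul_left _ _ _

theorem norm_eq_column (A : M.PreK2) : ‖A‖ = ‖column A‖ := rfl

theorem column_surjective : Function.Surjective (column (M := M)) := by
  intro ψ
  have h0 : ∀ ω, (Finsupp.linearCombination ℂ fun a => shift a (ψ (M.τ (-a) ω)))
      (Finsupp.single 0 1) = ψ ω := by
    intro ω
    rw [Finsupp.linearCombination_single, one_smul, neg_zero, M.τ_zero]
    ext x
    rw [shift_apply, sub_zero]
  have h1 : MemLp (fun ω => (Finsupp.linearCombination ℂ fun a => shift a (ψ (M.τ (-a) ω)))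
      (Finsupp.single 0 1)) 2 P := (Lp.memLp ψ).ae_eq (ae_of_all _ fun ω => (h0 ω).symm)
  refine ⟨⟨fun ω => Finsupp.linearCombination ℂ fun a => shift a (ψ (M.τ (-a) ω)), ?_, ?_, ?_⟩, ?_⟩
  · intro a
    simp only [Finsupp.linearCombination_single, one_smul]
    exact (shift a).continuous.comp_aestronglyMeasurable
      ((Lp.aestronglyMeasurable ψ).comp_measurePreserving (M.measurePreserving_τ (-a)))
  · refine fun a => ae_of_all _ fun ω φ => ?_
    induction φ using Finsupp.induction_linear with
    | zero => simp
    | add f g hf hg => simp [hf, hg]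
    | single x c =>
      rw [shiftFin_single, Finsupp.linearCombination_single, Finsupp.linearCombination_single,
        map_smul, shift_shift, ← M.τ_add, add_comm x a]
      congr 4
      abel
  · exact h1
  · exact Lp.ext (h1.coeFn_toLp.trans (ae_of_all _ h0))

instance : CompleteSpace M.PreK2 := by
  have h : Isometry (column (M := M)) := AddMonoidHomClass.isometry_of_norm _ fun _ => rfl
  exact (h.isUniformInducing.completeSpace_congr M.column_surjective).2 inferInstance

/-- The Hilbert space `𝒦₂` of measurable covariant operators with `E ‖A_ω δ_0‖² < ∞`; operators
at distance `0` from each other (equivalently, operators which agree almost surely) are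
identified. -/
abbrev K2 : Type _ := SeparationQuotient M.PreK2

theorem column_eq_zero_iff (A : M.PreK2) : column A = 0 ↔ ∀ᵐ ω ∂P, A.1 ω = 0 := by
  rw [Lp.eq_zero_iff_ae_eq_zero]
  have h1 : ⇑(column A) =ᵐ[P] fun ω => A.1 ω (Finsupp.single 0 1) := A.2.2.2.coeFn_toLp
  constructor
  · intro h
    have h2 : ∀ᵐ ω ∂P, ∀ a, A.1 ω (Finsupp.single a 1) = 0 := by
      refine ae_all_iff.2 fun a => ?_
      have h3 : ∀ᵐ ω ∂P, A.1 (M.τ a ω) (Finsupp.single a 1) = 0 := by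
        filter_upwards [h, h1, A.2.2.1 a] with ω e1 e2 e3
        have := e3 (Finsupp.single 0 1)
        rw [shiftFin_single, zero_add] at this
        rw [this, ← e2, e1]
        simp
      filter_upwards [(M.measurePreserving_τ (-a)).quasiMeasurePreserving.ae h3] with ω hω
      rwa [← M.τ_add, add_neg_cancel, M.τ_zero] at hω
    filter_upwards [h2] with ω hω
    refine Finsupp.lhom_ext fun a c => ?_
    have : Finsupp.single a c = c • Finsupp.single a (1 : ℂ) := by simp
    rw [this, map_smul, hω a]
    simp
  · intro h
    filter_upwards [h, h1] with ω e1 e2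
    rw [e2, e1]
    rfl

variable {M} in
/-- The operator on `𝒦₂` induced by a bounded operator on representatives. -/
noncomputable def liftOp (T : M.PreK2 →L[ℂ] M.PreK2) : M.K2 →L[ℂ] M.K2 :=
  SeparationQuotient.liftCLM ((SeparationQuotient.mkCLM ℂ M.PreK2) ∘L T) fun _ _ h =>
    SeparationQuotient.mk_eq_mk.2 (h.map T.continuous)

theorem aestronglyMeasurable_ham {ψ : Ω → L2 d} (hψ : AEStronglyMeasurable ψ P) :
    AEStronglyMeasurable (fun ω => M.ham ω (ψ ω)) P := by
  have hc : ∀ x : Lattice d, AEStronglyMeasurable (fun ω => ψ ω x) P := fun x =>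
    (lp.evalCLM ℂ (fun _ : Lattice d => ℂ) 2 x).continuous.comp_aestronglyMeasurable hψ
  refine ((-laplacian (d := d)).continuous.comp_aestronglyMeasurable hψ).add
    (aestronglyMeasurable_of_coord fun x => ?_)
  have hV : AEStronglyMeasurable (fun ω => (M.V ω x : ℂ)) P :=
    (Complex.measurable_ofReal.comp (M.measurable_V x)).aestronglyMeasurable
  obtain ⟨C, -, hC⟩ := M.exists_bound
  refine (hV.mul (hc x)).congr ?_
  filter_upwards [hC] with ω hω
  exact (mulOp_apply ⟨C, hω⟩ _ _).symm

theorem exists_norm_ham_le : ∃ C : ℝ, 0 ≤ C ∧ ∀ᵐ ω ∂P, ∀ φ, ‖M.ham ω φ‖ ≤ C * ‖φ‖ := by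
  obtain ⟨C, hC, h⟩ := M.exists_bound
  refine ⟨‖laplacian (d := d)‖ + C, by positivity, ?_⟩
  filter_upwards [h] with ω hω φ
  calc ‖M.ham ω φ‖ = ‖-laplacian φ + mulOp (M.V ω) φ‖ := rfl
    _ ≤ ‖-laplacian φ‖ + ‖mulOp (M.V ω) φ‖ := norm_add_le _ _
    _ ≤ _ := by
      rw [norm_neg, add_mul]
      exact add_le_add (ContinuousLinearMap.le_opNorm _ _) (norm_mulOp_apply_le hω φ)

theorem leftMul_mem (A : M.PreK2) :
    (fun ω => (M.ham ω).toLinearMap ∘ₗ A.1 ω) ∈ M.covariantOperators := by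
  refine ⟨fun a => M.aestronglyMeasurable_ham (A.2.1 a), fun a => ?_, ?_⟩
  · filter_upwards [A.2.2.1 a] with ω h φ
    simp [h φ, M.ham_covariant]
  · obtain ⟨C, -, hC⟩ := M.exists_norm_ham_le
    refine A.2.2.2.of_le_mul (c := C) (M.aestronglyMeasurable_ham (A.2.1 0)) ?_
    filter_upwards [hC] with ω hω
    exact hω _

theorem exists_norm_leftMul_le : ∃ C : ℝ, ∀ A : M.PreK2,
    ‖column (⟨_, M.leftMul_mem A⟩ : M.PreK2)‖ ≤ C * ‖column A‖ := by
  obtain ⟨C, -, hC⟩ := M.exists_norm_ham_le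
  refine ⟨C, fun A => Lp.norm_le_mul_norm_of_ae_le_mul ?_⟩
  have h1 : ⇑(column A) =ᵐ[P] fun ω => A.1 ω (Finsupp.single 0 1) := A.2.2.2.coeFn_toLp
  have h2 : ⇑(column (⟨_, M.leftMul_mem A⟩ : M.PreK2)) =ᵐ[P]
    fun ω => M.ham ω (A.1 ω (Finsupp.single 0 1)) := (M.leftMul_mem A).2.2.coeFn_toLp
  filter_upwards [hC, h1, h2] with ω e1 e2 e3
  rw [e2, e3]
  exact e1 _

theorem eLpNorm_column (A : M.PreK2) (a : Lattice d) :
    eLpNorm (fun ω => A.1 ω (Finsupp.single a 1)) 2 P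
      = eLpNorm (fun ω => A.1 ω (Finsupp.single 0 1)) 2 P := by
  rw [← eLpNorm_comp_measurePreserving (A.2.1 a) (M.measurePreserving_τ a)]
  refine eLpNorm_congr_norm_ae ?_
  filter_upwards [A.2.2.1 a] with ω h
  have := h (Finsupp.single 0 1)
  rw [shiftFin_single, zero_add] at this
  rw [Function.comp_apply, this, norm_shift_apply]

theorem memLp_column (A : M.PreK2) (a : Lattice d) :
    MemLp (fun ω => A.1 ω (Finsupp.single a 1)) 2 P :=
  ⟨A.2.1 a, (M.eLpNorm_column A a).trans_lt A.2.2.2.2⟩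

theorem norm_column (A : M.PreK2) (a : Lattice d) :
    ‖(M.memLp_column A a).toLp‖ = ‖column A‖ := by
  rw [Lp.norm_toLp, M.eLpNorm_column]
  exact (Lp.norm_toLp _ A.2.2.2).symm

theorem rightMul_apply (A : M.PreK2) (ω : Ω) (a : Lattice d) :
    A.1 ω (M.hamFin ω (Finsupp.single a 1)) =
      (∑ j : Fin d, (A.1 ω (Finsupp.single (a + Pi.single j 1) 1)
        + A.1 ω (Finsupp.single (a - Pi.single j 1) 1)))
      + (M.V ω a : ℂ) • A.1 ω (Finsupp.single a 1) := by
  have : Finsupp.single a (M.V ω a : ℂ) = (M.V ω a : ℂ) • Finsupp.single a (1 : ℂ) := by simp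
  simp only [hamFin, laplacianFin, LinearMap.neg_apply, neg_neg, LinearMap.add_apply, LinearMap.sum_apply,
    shiftFin_single, mulFin_single, mul_one, this, map_add, map_sum, map_smul, sub_eq_add_neg]

theorem memLp_potential_smul (A : M.PreK2) (a : Lattice d) :
    MemLp (fun ω => (M.V ω a : ℂ) • A.1 ω (Finsupp.single a 1)) 2 P := by
  obtain ⟨C, -, hC⟩ := M.exists_bound
  refine (M.memLp_column A a).of_le_mul (c := C)
    ((Complex.measurable_ofReal.comp (M.measurable_V a)).aestronglyMeasurable.smul (A.2.1 a)) ?_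
  filter_upwards [hC] with ω hω
  rw [norm_smul, Complex.norm_real]
  exact mul_le_mul_of_nonneg_right (hω a) (norm_nonneg _)

theorem rightMul_mem (A : M.PreK2) :
    (fun ω => A.1 ω ∘ₗ M.hamFin ω) ∈ M.covariantOperators := by
  refine ⟨fun a => ?_, fun a => ?_, ?_⟩
  · simp only [LinearMap.comp_apply, M.rightMul_apply]
    refine (Finset.aestronglyMeasurable_fun_sum _ fun j _ => (A.2.1 _).add (A.2.1 _)).add ?_
    exact (Complex.measurable_ofReal.comp (M.measurable_V a)).aestronglyMeasurable.smul (A.2.1 a)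
  · filter_upwards [A.2.2.1 a] with ω h φ
    simp [M.hamFin_covariant, h]
  · simp only [LinearMap.comp_apply, M.rightMul_apply]
    exact (memLp_finsetSum _ fun j _ => (M.memLp_column A _).add (M.memLp_column A _)).add
      (M.memLp_potential_smul A 0)

theorem exists_norm_rightMul_le : ∃ C : ℝ, ∀ A : M.PreK2,
    ‖column (⟨_, M.rightMul_mem A⟩ : M.PreK2)‖ ≤ C * ‖column A‖ := by
  obtain ⟨C, -, hC⟩ := M.exists_bound
  refine ⟨∑ _j : Fin d, (1 + 1) + C, fun A => ?_⟩
  have h : column (⟨_, M.rightMul_mem A⟩ : M.PreK2)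
      = (∑ j : Fin d, ((M.memLp_column A (0 + Pi.single j 1)).toLp
        + (M.memLp_column A (0 - Pi.single j 1)).toLp)) + (M.memLp_potential_smul A 0).toLp := by
    refine Lp.ext ?_
    have hX : ⇑(column (⟨_, M.rightMul_mem A⟩ : M.PreK2)) =ᵐ[P]
      fun ω => A.1 ω (M.hamFin ω (Finsupp.single 0 1)) := (M.rightMul_mem A).2.2.coeFn_toLp
    have hj : ∀ᵐ ω ∂P, ∀ j : Fin d, ((M.memLp_column A (0 + Pi.single j 1)).toLp
        + (M.memLp_column A (0 - Pi.single j 1)).toLp) ω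
        = A.1 ω (Finsupp.single (0 + Pi.single j 1) 1)
          + A.1 ω (Finsupp.single (0 - Pi.single j 1) 1) := by
      refine ae_all_iff.2 fun j => ?_
      filter_upwards [Lp.coeFn_add (M.memLp_column A (0 + Pi.single j 1)).toLp
        (M.memLp_column A (0 - Pi.single j 1)).toLp,
        (M.memLp_column A (0 + Pi.single j 1)).coeFn_toLp,
        (M.memLp_column A (0 - Pi.single j 1)).coeFn_toLp] with ω e1 e2 e3
      rw [e1, Pi.add_apply, e2, e3]
    filter_upwards [hX, hj, Lp.coeFn_add (∑ j : Fin d,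
        ((M.memLp_column A (0 + Pi.single j 1)).toLp
        + (M.memLp_column A (0 - Pi.single j 1)).toLp)) (M.memLp_potential_smul A 0).toLp,
      Lp.coeFn_fun_finsetSum Finset.univ fun j : Fin d =>
        ((M.memLp_column A (0 + Pi.single j 1)).toLp
        + (M.memLp_column A (0 - Pi.single j 1)).toLp),
      (M.memLp_potential_smul A 0).coeFn_toLp] with ω e1 e2 e3 e4 e5
    rw [e1, e3, Pi.add_apply, e4, e5, M.rightMul_apply]
    simp only [e2]
  have hV : ‖(M.memLp_potential_smul A 0).toLp‖ ≤ C * ‖column A‖ := by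
    refine Lp.norm_le_mul_norm_of_ae_le_mul ?_
    have h1 : ⇑(column A) =ᵐ[P] fun ω => A.1 ω (Finsupp.single 0 1) := A.2.2.2.coeFn_toLp
    filter_upwards [hC, h1, (M.memLp_potential_smul A 0).coeFn_toLp] with ω e1 e2 e3
    rw [e2, e3, norm_smul, Complex.norm_real]
    exact mul_le_mul_of_nonneg_right (e1 0) (norm_nonneg _)
  rw [h, add_mul, Finset.sum_mul]
  refine (norm_add_le _ _).trans (add_le_add ((norm_sum_le _ _).trans ?_) hV)
  refine Finset.sum_le_sum fun j _ => (norm_add_le _ _).trans ?_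
  rw [M.norm_column, M.norm_column, add_mul, one_mul]

/-- Left multiplication by `H`: `(ℋ_L A)_ω = H_ω A_ω`. -/
noncomputable def leftMul : M.K2 →L[ℂ] M.K2 :=
  liftOp <| LinearMap.mkContinuousOfExistsBound
    { toFun := fun A => ⟨fun ω => (M.ham ω).toLinearMap ∘ₗ A.1 ω, M.leftMul_mem A⟩
      map_add' := fun _ _ => Subtype.ext <| funext fun _ => LinearMap.comp_add _ _ _
      map_smul' := fun _ _ => Subtype.ext <| funext fun _ => LinearMap.comp_smul _ _ _ } M.exists_norm_leftMul_le

/-- Right multiplication by `H`: `(ℋ_R A)_ω = A_ω H_ω`. -/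
noncomputable def rightMul : M.K2 →L[ℂ] M.K2 :=
  liftOp <| LinearMap.mkContinuousOfExistsBound
    { toFun := fun A => ⟨fun ω => A.1 ω ∘ₗ M.hamFin ω, M.rightMul_mem A⟩
      map_add' := fun _ _ => Subtype.ext <| funext fun _ => LinearMap.add_comp _ _ _
      map_smul' := fun _ _ => Subtype.ext <| funext fun _ => LinearMap.smul_comp _ _ _ } M.exists_norm_rightMul_le

/-- The Liouvillian `ℒ A = [H, A]`. -/
noncomputable def liouvillian : M.K2 →L[ℂ] M.K2 := M.leftMul - M.rightMul

/-- The Fermi function `f_μ^T(E) = (e^{(E-μ)/T} + 1)⁻¹` at temperature `T > 0`. -/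
noncomputable def _root_.Anderson.fermi (μ T E : ℝ) : ℝ := (Real.exp ((E - μ) / T) + 1)⁻¹

/-- The operator `ℱ_μ^T = f_μ^T(ℋ_L) - f_μ^T(ℋ_R)` on `𝒦₂`. -/
noncomputable def fermiCommutator (μ T : ℝ) : M.K2 →L[ℂ] M.K2 :=
  functionOf (fermi μ T) M.leftMul - functionOf (fermi μ T) M.rightMul

open Classical in
/-- The element of `𝒦₂` given by a family of operators on the finitely supported functions
(and `0` if the family is not a measurable covariant operator with `E ‖A_ω δ_0‖² < ∞`). -/
noncomputable def toK2 (A : Ω → (Fin2 d →ₗ[ℂ] L2 d)) : M.K2 :=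
  if h : A ∈ M.covariantOperators then SeparationQuotient.mk (⟨A, h⟩ : M.PreK2) else 0

section Position
variable [NeZero d]

/-- The multiplication `X₁` by the first coordinate on the finitely supported functions. -/
noncomputable def _root_.Anderson.posFin : Fin2 d →ₗ[ℂ] Fin2 d :=
  mulFin fun x => ((x 0 : ℤ) : ℝ)

open Classical in
/-- The multiplication `X₁` by the first coordinate on its maximal domain in `ℓ²(ℤ^d)`
(and `0` off that domain). -/
noncomputable def _root_.Anderson.posOp (φ : L2 d) : L2 d :=
  if h : Memℓp (fun x : Lattice d => ((x 0 : ℤ) : ℂ) * φ x) 2 then ⟨_, h⟩ else 0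

/-- The velocity operator `Ẋ₁ = i [H, X₁]` as an element of `𝒦₂`. -/
noncomputable def velocity : M.K2 :=
  M.toK2 fun ω => Complex.I • incl ∘ₗ (M.hamFin ω ∘ₗ posFin - posFin ∘ₗ M.hamFin ω)

/-- The operator `Y_μ^T = i [X₁, f_μ^T(H)]` on the finitely supported functions: the linear map
with `Y_ω δ_a = i (X₁ f_μ^T(H_ω) δ_a - f_μ^T(H_ω) X₁ δ_a)`. -/
noncomputable def fermiVelocityFamily (μ T : ℝ) (ω : Ω) : Fin2 d →ₗ[ℂ] L2 d :=
  Finsupp.linearCombination ℂ fun a =>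
    Complex.I • (posOp (functionOf (fermi μ T) (M.ham ω) (delta a))
      - functionOf (fermi μ T) (M.ham ω) (posOp (delta a)))

/-- `Y_μ^T = i [X₁, f_μ^T(H)]` as an element of `𝒦₂`. -/
noncomputable def fermiVelocity (μ T : ℝ) : M.K2 := M.toK2 (M.fermiVelocityFamily μ T)

/-- The conductivity measure `Σ_μ^T(B) = π ⟪Ẋ₁, χ_B(ℒ) Y_μ^T⟫`. -/
noncomputable def conductivity (μ T : ℝ) (B : Set ℝ) : ℂ :=
  Real.pi * inner ℂ M.velocity (spectralProjection M.liouvillian B (M.fermiVelocity μ T))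

open Classical in
/-- The bounded operator `Q = - ℒ_⊥⁻¹ ℱ_μ^T` on `𝒦₂`, where `ℒ_⊥⁻¹ = g(ℒ)` is the pseudo-inverse
of `ℒ`, with `g(t) = 1/t` for `t ≠ 0` and `g(0) = 0`. It is the operator `Q` such that, for every
`A`, the vector `ℱ_μ^T A` is in the domain of `ℒ_⊥⁻¹` and `ℒ_⊥⁻¹ (ℱ_μ^T A) = - Q A`. -/
noncomputable def pseudoInverseComp (μ T : ℝ) : M.K2 →L[ℂ] M.K2 :=
  if h : ∃ Q : M.K2 →L[ℂ] M.K2, ∀ A,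
      IsBorelApply M.liouvillian (fun t => t⁻¹) (M.fermiCommutator μ T A) (-(Q A))
    then h.choose else 0

/-- The vector `(- ℒ_⊥⁻¹ ℱ_μ^T)^{1/2} Ẋ₁`. -/
noncomputable def rootVelocity (μ T : ℝ) : M.K2 :=
  functionOf Real.sqrt (M.pseudoInverseComp μ T) M.velocity

/-- The measure `Γ_μ^T(B) = π ⟪(- ℒ_⊥⁻¹ ℱ_μ^T)^{1/2} Ẋ₁, χ_B(ℒ) (- ℒ_⊥⁻¹ ℱ_μ^T)^{1/2} Ẋ₁⟫`. -/
noncomputable def conductivityPerp (μ T : ℝ) (B : Set ℝ) : ℂ :=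
  Real.pi * inner ℂ (M.rootVelocity μ T)
    (spectralProjection M.liouvillian B (M.rootVelocity μ T))

end Position

end AndersonModel

/-- The set function `Φ`, on the Borel sets of `ℝ`, is a finite positive Borel measure. -/
def IsFiniteBorelMeasure (Φ : Set ℝ → ℂ) : Prop :=
  ∃ m : Measure ℝ, IsFiniteMeasure m ∧ ∀ B, MeasurableSet B → Φ B = ((m.real B : ℝ) : ℂ)

end Anderson

/-!
The operators `ℋ_L` and `ℋ_R` of left and right multiplication by `H` on `𝒦₂` are bounded,
self-adjoint (`isSelfAdjoint_rightMul` is where covariance and the invariance of `P` enter) and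
commute, so `N = ℋ_L + i ℋ_R` is normal and every continuous function of two real variables can be
evaluated at `(ℋ_L, ℋ_R)` by the continuous functional calculus of `N`. Let `D` be the value of
`-(f(x) - f(y)) / (x - y)`, extended by `-f'(x)` to the diagonal, where `f` is the Fermi function.
Since `0 < -f' ≤ 1 / T`, the operator `D` is positive, invertible and bounded by `1 / T`; it has an
invertible positive square root `S` which commutes with `ℒ = ℋ_L - ℋ_R`, and `ℒ D = -ℱ`.

The heart of the matter is the identity `Y = i [X₁, f(H)] = D Ẋ₁`
(`represents_functionVelocityFamily`). If `f` is a polynomial, it is the Leibniz rule. In general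
one approximates `f` and `f'` uniformly by polynomials `p` and `p'`: the divided differences converge
in norm, hence the operators `i [X₁, p(H)]` converge in `𝒦₂`, and almost surely along a subsequence,
columnwise; on matrix elements the limit is `i (x₁ - a₁) f(H)(x, a)`. This also shows that
`f(H) δ_a` is in the domain of `X₁` and that `Y` belongs to `𝒦₂`.

With `P₀` the projection onto `ker ℒ`, the identity `ℒ D = -ℱ` gives `-ℒ_⊥⁻¹ ℱ = (1 - P₀) D`, whose
square root is `(1 - P₀) S`. Consequently `Σ(B) = π ⟪Ẋ₁, χ_B(ℒ) S² Ẋ₁⟫ = π ⟪S Ẋ₁, χ_B(ℒ) S Ẋ₁⟫` and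
`Γ(B) = π ⟪w, χ_B(ℒ) w⟫` with `w = (1 - P₀) S Ẋ₁`: both are `π` times a spectral measure of `ℒ`
(`exists_conductivity_eq_spectralMeasure`), of total mass `π ‖S Ẋ₁‖²` and `π ‖(1 - P₀) S Ẋ₁‖²`.
The former is at most `π ‖Ẋ₁‖² / T`, which yields the limits. The latter is positive because `S` is
injective and `Ẋ₁ ∉ ker ℒ` (`liouvillian_velocity_ne_zero`): the matrix element of `[H, Ẋ₁]` between
the neighbouring sites `0` and `e₁` is a multiple of `V(e₁) - V(0)`, and this is almost surely nonzero
because the potential is independent at distinct sites with a law that has no atoms.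
-/

namespace Anderson

/-! ### Spectral measures of a bounded self-adjoint operator -/

section SpectralMeasure
variable {K : Type*} [NormedAddCommGroup K] [InnerProductSpace ℂ K] [CompleteSpace K]
  {A S : K →L[ℂ] K} {x z : K}

theorem exists_compactlySupported_eqOn_Icc {g : ℝ → ℝ} (hg : Continuous g) (R : ℝ) :
    ∃ f : C_c(ℝ, ℝ), ∀ t ∈ Set.Icc (-R) R, f t = g t := by
  refine ⟨⟨⟨fun t => g t * max 0 (min 1 (R + 1 - |t|)), by fun_prop⟩, ?_⟩, ?_⟩
  · refine HasCompactSupport.intro (isCompact_Icc (a := -(R + 1)) (b := R + 1)) fun t ht => ?_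
    have : R + 1 - |t| ≤ 0 := by
      rw [Set.mem_Icc, ← abs_le] at ht
      linarith
    simp [max_eq_left (min_le_of_right_le this)]
  · intro t ht
    have : 1 ≤ R + 1 - |t| := by
      rw [Set.mem_Icc, ← abs_le] at ht
      linarith
    simp [min_eq_left this]

theorem spectrum_subset_Icc_norm (A : K →L[ℂ] K) : spectrum ℝ A ⊆ Set.Icc (-‖A‖) ‖A‖ := by
  intro t ht
  have h := spectrum.norm_le_norm_mul_of_mem ht
  have h1 : ‖(1 : K →L[ℂ] K)‖ ≤ 1 := ContinuousLinearMap.norm_id_le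
  rw [Set.mem_Icc, ← abs_le, ← Real.norm_eq_abs]
  exact h.trans (mul_le_of_le_one_right (norm_nonneg _) h1)

/-- The spectral measure is carried by `[-‖A‖, ‖A‖]`: a compact set outside this interval is
dominated by a function which vanishes on the spectrum. -/
theorem spectralMeasure_compl_Icc (A : K →L[ℂ] K) (x : K) :
    spectralMeasure A x (Set.Icc (-‖A‖) ‖A‖)ᶜ = 0 := by
  have ho : IsOpen (Set.Icc (-‖A‖) ‖A‖)ᶜ := isClosed_Icc.isOpen_compl
  rw [ho.measure_eq_iSup_isCompact]
  simp only [ENNReal.iSup_eq_zero]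
  intro C hC hcpt
  obtain ⟨f, h1, h0, hc, h01⟩ := exists_continuous_one_zero_of_isCompact hcpt
    (isClosed_Icc (a := -‖A‖) (b := ‖A‖)) (Set.disjoint_left.2 fun t ht ht' => hC ht ht')
  have hz : cfc (fun t : ℝ => f t) A = 0 := by
    have : cfc (fun t : ℝ => f t) A = cfc (fun _ : ℝ => (0 : ℝ)) A :=
      cfc_congr fun t ht => h0 (spectrum_subset_Icc_norm A ht)
    rw [this, cfc_const_zero]
  have hi := integral_spectralMeasure A x ⟨f, hc⟩
  have hint : Integrable f (spectralMeasure A x) := f.continuous.integrable_of_hasCompactSupport hc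
  have hle : ∫ t, C.indicator 1 t ∂(spectralMeasure A x) ≤ ∫ t, f t ∂(spectralMeasure A x) := by
    refine integral_mono_of_nonneg (ae_of_all _ fun t => Set.indicator_nonneg (by simp) t) hint
      (ae_of_all _ fun t => ?_)
    by_cases ht : t ∈ C
    · simp [ht, h1 ht]
    · simpa [ht] using (h01 t).1
  rw [integral_indicator_one hcpt.measurableSet] at hle
  have hi' : ∫ t, f t ∂(spectralMeasure A x) = 0 := by
    refine hi.trans ?_
    change RCLike.re (inner ℂ x (cfc (fun t : ℝ => f t) A x)) = 0
    rw [hz]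
    simp
  rw [hi'] at hle
  have := (measureReal_eq_zero_iff hcpt.measure_lt_top.ne).1 (le_antisymm hle measureReal_nonneg)
  exact this

theorem ae_mem_Icc_norm (A : K →L[ℂ] K) (x : K) :
    ∀ᵐ t ∂(spectralMeasure A x), t ∈ Set.Icc (-‖A‖) ‖A‖ := spectralMeasure_compl_Icc A x

instance (A : K →L[ℂ] K) (x : K) : IsFiniteMeasure (spectralMeasure A x) := by
  refine ⟨?_⟩
  rw [← measure_add_measure_compl (measurableSet_Icc (a := -‖A‖) (b := ‖A‖)),
    spectralMeasure_compl_Icc, add_zero]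
  exact isCompact_Icc.measure_lt_top

theorem cfc_congr_of_eqOn_Icc {f g : ℝ → ℝ} (h : ∀ t ∈ Set.Icc (-‖A‖) ‖A‖, f t = g t) :
    cfc f A = cfc g A :=
  cfc_congr fun t ht => h t (spectrum_subset_Icc_norm A ht)

/-- The defining identity of the spectral measure holds for all continuous functions, because
the measure is carried by the compact interval `[-‖A‖, ‖A‖]`. -/
theorem integral_spectralMeasure_of_continuous (A : K →L[ℂ] K) (x : K) {g : ℝ → ℝ}
    (hg : Continuous g) :
    ∫ t, g t ∂(spectralMeasure A x) = RCLike.re (inner ℂ x (cfc g A x)) := by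
  obtain ⟨f, hf⟩ := exists_compactlySupported_eqOn_Icc hg ‖A‖
  rw [← cfc_congr_of_eqOn_Icc hf, ← integral_spectralMeasure]
  refine integral_congr_ae ?_
  filter_upwards [ae_mem_Icc_norm A x] with t ht using (hf t ht).symm

theorem eLpNorm_spectralMeasure_of_continuous (A : K →L[ℂ] K) (x : K) {g : ℝ → ℝ}
    (hg : Continuous g) :
    eLpNorm g 2 (spectralMeasure A x) = ENNReal.ofReal ‖cfc g A x‖ := by
  obtain ⟨f, hf⟩ := exists_compactlySupported_eqOn_Icc hg ‖A‖
  rw [← cfc_congr_of_eqOn_Icc hf, ← eLpNorm_spectralMeasure]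
  refine eLpNorm_congr_ae ?_
  filter_upwards [ae_mem_Icc_norm A x] with t ht using (hf t ht).symm

theorem measureReal_univ_spectralMeasure (hA : IsSelfAdjoint A) (x : K) :
    (spectralMeasure A x).real Set.univ = ‖x‖ ^ 2 := by
  have := integral_spectralMeasure_of_continuous A x (continuous_const (y := (1 : ℝ)))
  rw [cfc_const_one ℝ A, one_apply_eq_self, inner_self_eq_norm_sq] at this
  simpa using this

theorem IsBorelApply.borelApply_eq {g : ℝ → ℝ} (h : IsBorelApply A g x z) :
    borelApply A g x = z := by
  have hex : ∃ z, IsBorelApply A g x z := ⟨z, h⟩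
  rw [borelApply, dif_pos hex]
  exact hex.choose_spec.unique h

/-- The Borel functional calculus commutes with every bounded operator that commutes with `A`:
one approximates `g` by continuous functions in `L²(μ_x)` and `L²(μ_{Sx})` simultaneously. -/
theorem IsBorelApply.map_of_commute {g : ℝ → ℝ} (h : IsBorelApply A g x z)
    (hS : Commute A S) (hg : MemLp g 2 (spectralMeasure A (S x))) :
    IsBorelApply A g (S x) (S z) := by
  -- The sum of the two measures is again a finite Borel measure, hence regular.
  have hsum : MemLp g 2 (spectralMeasure A x + spectralMeasure A (S x)) := by
    refine ⟨h.1.1.add_measure hg.1, ?_⟩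
    rw [eLpNorm_lt_top_iff_lintegral_rpow_enorm_lt_top (by norm_num) (by norm_num),
      lintegral_add_measure]
    exact ENNReal.add_lt_top.2
      ⟨(eLpNorm_lt_top_iff_lintegral_rpow_enorm_lt_top (by norm_num) (by norm_num)).1 h.1.2,
        (eLpNorm_lt_top_iff_lintegral_rpow_enorm_lt_top (by norm_num) (by norm_num)).1 hg.2⟩
  have happ : ∀ ε : ℝ, 0 < ε → ∃ f : C_c(ℝ, ℝ),
      eLpNorm (fun t => g t - f t) 2 (spectralMeasure A x) ≤ ENNReal.ofReal ε ∧
      eLpNorm (fun t => g t - f t) 2 (spectralMeasure A (S x)) ≤ ENNReal.ofReal ε := by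
    intro ε hε
    obtain ⟨f, h1, h2, h3, -⟩ := hsum.exists_hasCompactSupport_eLpNorm_sub_le (by norm_num)
      (ε := ENNReal.ofReal ε) (by simpa using hε)
    exact ⟨⟨⟨f, h3⟩, h1⟩, (eLpNorm_mono_measure _ (Measure.le_add_right le_rfl)).trans h2,
      (eLpNorm_mono_measure _ (Measure.le_add_left le_rfl)).trans h2⟩
  refine ⟨hg, fun ε hε => ?_⟩
  have hpos : 0 < 1 + 3 * ‖S‖ := by positivity
  obtain ⟨f, hf, hf'⟩ := happ (ε / (1 + 3 * ‖S‖)) (by positivity)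
  obtain ⟨f', hf2, hf2'⟩ := h.2 (ε / (1 + 3 * ‖S‖)) (by positivity)
  have hle : ε / (1 + 3 * ‖S‖) ≤ ε :=
    div_le_self hε.le (by linarith [norm_nonneg S])
  refine ⟨f, hf'.trans (ENNReal.ofReal_le_ofReal hle), ?_⟩
  have hd := norm_cfc_sub_le h.1.1 (by positivity) (by positivity) hf hf2
  have hcomm : cfc (fun t : ℝ => f t) A (S x) = S (cfc (fun t : ℝ => f t) A x) :=
    congrArg (fun B : K →L[ℂ] K => B x) (hS.cfc_real (fun t : ℝ => f t)).eq
  rw [hcomm, ← map_sub]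
  refine (S.le_opNorm _).trans ?_
  have h3 := norm_sub_le_norm_sub_add_norm_sub (cfc (fun t : ℝ => f t) A x)
    (cfc (fun t : ℝ => f' t) A x) z
  have h4 : ‖cfc (fun t : ℝ => f t) A x - z‖ ≤ 3 * (ε / (1 + 3 * ‖S‖)) := by linarith
  calc ‖S‖ * _ ≤ ‖S‖ * (3 * (ε / (1 + 3 * ‖S‖))) := by gcongr
    _ = (3 * ‖S‖ / (1 + 3 * ‖S‖)) * ε := by ring
    _ ≤ 1 * ε := by
      gcongr
      exact (div_le_one hpos).2 (by linarith)
    _ = ε := one_mul ε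

theorem memLp_indicator_spectralMeasure (A : K →L[ℂ] K) (x : K) {B : Set ℝ}
    (hB : MeasurableSet B) : MemLp (B.indicator fun _ => (1 : ℝ)) 2 (spectralMeasure A x) :=
  memLp_indicator_const 2 hB 1 (Or.inr (measure_ne_top _ _))

theorem isBorelApply_spectralProjection (A : K →L[ℂ] K) (x : K) {B : Set ℝ}
    (hB : MeasurableSet B) :
    IsBorelApply A (B.indicator fun _ => 1) x (spectralProjection A B x) := by
  obtain ⟨z, hz⟩ := exists_isBorelApply (A := A) (x := x) (memLp_indicator_spectralMeasure A x hB)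
  rwa [spectralProjection, hz.borelApply_eq]

theorem spectralProjection_map_of_commute (hS : Commute A S) (x : K) {B : Set ℝ}
    (hB : MeasurableSet B) :
    spectralProjection A B (S x) = S (spectralProjection A B x) :=
  ((isBorelApply_spectralProjection A x hB).map_of_commute hS
    (memLp_indicator_spectralMeasure A (S x) hB)).borelApply_eq

theorem inner_cfc_eq_integral (A : K →L[ℂ] K) (x : K) {g : ℝ → ℝ} (hg : Continuous g) :
    inner ℂ x (cfc g A x) = ((∫ t, g t ∂(spectralMeasure A x) : ℝ) : ℂ) := by
  rw [integral_spectralMeasure_of_continuous A x hg]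
  have h : IsSelfAdjoint (cfc g A) := cfc_predicate _ _
  exact ((ContinuousLinearMap.isSelfAdjoint_iff_isSymmetric.1 h).coe_re_inner_self_apply x).symm

/-- `⟨x, χ_B(A) x⟩ = μ_x(B)`. -/
theorem inner_spectralProjection (A : K →L[ℂ] K) (x : K) {B : Set ℝ} (hB : MeasurableSet B) :
    inner ℂ x (spectralProjection A B x) = (((spectralMeasure A x).real B : ℝ) : ℂ) := by
  refine eq_of_forall_dist_le fun ε hε => ?_
  have h := isBorelApply_spectralProjection A x hB
  set z := spectralProjection A B x
  set ν := spectralMeasure A x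
  set c : ℝ := ‖x‖ + ν.real Set.univ ^ (2⁻¹ : ℝ) + 1 with hc
  have hcpos : 0 < c := by positivity
  obtain ⟨f, hf, hfz⟩ := h.2 (ε / c) (by positivity)
  have hfi : Integrable (fun t => f t) ν := f.continuous.integrable_of_hasCompactSupport
    f.hasCompactSupport
  have hgi : Integrable (B.indicator fun _ => (1 : ℝ)) ν :=
    (memLp_indicator_spectralMeasure A x hB).integrable (by norm_num)
  have h1 : ‖inner ℂ x z - inner ℂ x (cfc (fun t : ℝ => f t) A x)‖ ≤ ‖x‖ * (ε / c) := by
    rw [← inner_sub_right]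
    refine (norm_inner_le_norm _ _).trans ?_
    rw [norm_sub_rev]
    gcongr
  have h2 : ‖(∫ t, f t ∂ν) - ν.real B‖ ≤ ε / c * ν.real Set.univ ^ (2⁻¹ : ℝ) := by
    have e : ν.real B = ∫ t, B.indicator (fun _ => (1 : ℝ)) t ∂ν := by
      rw [integral_indicator_const _ hB]; simp
    rw [e, ← integral_sub hfi hgi]
    refine (norm_integral_le_integral_norm _).trans ?_
    have e2 := eLpNorm_le_eLpNorm_mul_rpow_measure_univ (μ := ν) (p := 1) (q := 2) (by norm_num)
      (hgi.sub hfi).aestronglyMeasurable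
    have e3 : ∫ t, ‖f t - B.indicator (fun _ => (1 : ℝ)) t‖ ∂ν
        = (eLpNorm ((B.indicator fun _ => (1 : ℝ)) - fun t => f t) 1 ν).toReal := by
      rw [eLpNorm_one_eq_lintegral_enorm, integral_norm_eq_lintegral_enorm
        (f := fun t => f t - B.indicator (fun _ => (1 : ℝ)) t) (hfi.sub hgi).aestronglyMeasurable]
      congr 1
      refine lintegral_congr fun t => ?_
      rw [Pi.sub_apply, ← enorm_neg, neg_sub]
    rw [e3]
    refine ENNReal.toReal_le_of_le_ofReal (by positivity) (e2.trans ?_)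
    rw [ENNReal.ofReal_mul (by positivity), ← ENNReal.ofReal_rpow_of_nonneg (by positivity)
      (by norm_num), ofReal_measureReal]
    refine mul_le_mul' hf (le_of_eq ?_)
    norm_num
  rw [inner_cfc_eq_integral A x (g := fun t => f t) f.continuous] at h1
  rw [dist_eq_norm]
  have h3 := norm_sub_le_norm_sub_add_norm_sub (inner ℂ x z) ((∫ t, f t ∂ν : ℝ) : ℂ)
    ((ν.real B : ℝ) : ℂ)
  rw [← Complex.ofReal_sub, Complex.norm_real] at h3
  calc _ ≤ _ := h3
    _ ≤ ‖x‖ * (ε / c) + ε / c * ν.real Set.univ ^ (2⁻¹ : ℝ) := add_le_add h1 h2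
    _ = (‖x‖ + ν.real Set.univ ^ (2⁻¹ : ℝ)) / c * ε := by ring
    _ ≤ 1 * ε := by
      gcongr
      exact (div_le_one hcpos).2 (by linarith)
    _ = ε := one_mul ε

/-- The spectral measures of `A x` and `x` are related by `dμ_{Ax}(t) = t² dμ_x(t)`. -/
theorem spectralMeasure_map_self (hA : IsSelfAdjoint A) (x : K) :
    spectralMeasure A (A x)
      = (spectralMeasure A x).withDensity fun t => ENNReal.ofReal (t ^ 2) := by
  have hae : ∀ᵐ t ∂(spectralMeasure A x), t ^ 2 ≤ ‖A‖ ^ 2 := by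
    filter_upwards [ae_mem_Icc_norm A x] with t ht
    rw [sq_le_sq, abs_of_nonneg (norm_nonneg A)]
    exact abs_le.2 ht
  have hfin : IsFiniteMeasure
      ((spectralMeasure A x).withDensity fun t => ENNReal.ofReal (t ^ 2)) := by
    refine isFiniteMeasure_withDensity_ofReal ?_
    refine (Integrable.of_bound (C := ‖A‖ ^ 2) (by fun_prop) ?_).2
    filter_upwards [hae] with t ht
    rwa [Real.norm_of_nonneg (sq_nonneg t)]
  refine Measure.ext_of_integral_eq_on_compactlySupported fun f => ?_
  rw [integral_withDensity_eq_integral_toReal_smul (by fun_prop) (by simp)]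
  simp only [ENNReal.toReal_ofReal (sq_nonneg _), smul_eq_mul]
  have hf : Continuous fun t => f t := f.continuous
  rw [integral_spectralMeasure_of_continuous A (A x) hf,
    integral_spectralMeasure_of_continuous A x (g := fun t => t ^ 2 * f t) (by fun_prop)]
  have e : cfc (fun t : ℝ => t ^ 2 * f t) A = A * cfc (fun t : ℝ => f t) A * A := by
    have : (fun t : ℝ => t ^ 2 * f t) = fun t => t * f t * t := by ext t; ring
    rw [this, cfc_mul (a := A) (fun t : ℝ => t * f t) (fun t => t),
      cfc_mul (a := A) (fun t : ℝ => t) (fun t => f t), cfc_id' ℝ A]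
  rw [e]
  exact congrArg RCLike.re (ContinuousLinearMap.isSelfAdjoint_iff_isSymmetric.1 hA x _)

/-- For `g(t) = 1/t`, `g(0) = 0`, one has `g(A) A x = x - P x`, where `P` is the orthogonal
projection onto the kernel of `A`. -/
theorem isBorelApply_inv_map_self (hA : IsSelfAdjoint A) (x : K) :
    IsBorelApply A (fun t => t⁻¹) (A x) (x - A.ker.starProjection x) := by
  -- `∫ t⁻² dμ_{Ax} = ∫ t⁻² t² dμ_x ≤ μ_x(ℝ)`
  have hmem : MemLp (fun t : ℝ => t⁻¹) 2 (spectralMeasure A (A x)) := by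
    refine ⟨measurable_inv.aestronglyMeasurable, ?_⟩
    rw [eLpNorm_lt_top_iff_lintegral_rpow_enorm_lt_top (by norm_num) (by norm_num),
      spectralMeasure_map_self hA, lintegral_withDensity_eq_lintegral_mul _ (by fun_prop)
        (by fun_prop)]
    refine lt_of_le_of_lt (lintegral_mono (g := fun _ => 1) fun t => ?_) ?_
    · rcases eq_or_ne t 0 with rfl | ht
      · simp
      · simp only [Pi.mul_apply, ENNReal.toReal_ofNat, ENNReal.rpow_ofNat]
        rw [← ofReal_norm, ← ENNReal.ofReal_pow (norm_nonneg _),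
          ← ENNReal.ofReal_mul (sq_nonneg t)]
        simp [ht]
    · simp
  obtain ⟨z, hz⟩ := exists_isBorelApply hmem
  have hsymm := ContinuousLinearMap.isSelfAdjoint_iff_isSymmetric.1 hA
  have hzero : ∀ᵐ t ∂(spectralMeasure A (A x)), t ≠ 0 := by
    rw [spectralMeasure_map_self hA, ae_withDensity_iff (by fun_prop)]
    refine ae_of_all _ fun t ht h0 => ht ?_
    simp [h0]
  -- The vector `z = g(A) A x` is the limit of `f(A) A x`; it is orthogonal to `ker A` and satisfies
  -- `A z = A x`, which determines it.
  have horth : z ∈ A.kerᗮ := by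
    rw [Submodule.mem_orthogonal]
    intro k hk
    have hk' : A k = 0 := hk
    refine norm_le_zero_iff.1 (le_of_forall_pos_le_add fun ε hε => ?_)
    obtain ⟨f, -, hf⟩ := hz.2 (ε / (‖k‖ + 1)) (by positivity)
    have e0 : inner ℂ k (cfc (fun t : ℝ => f t) A (A x)) = 0 := by
      have hcomm : cfc (fun t : ℝ => f t) A (A x) = A (cfc (fun t : ℝ => f t) A x) :=
        congrArg (fun B : K →L[ℂ] K => B x)
          ((Commute.refl A).cfc_real (fun t : ℝ => f t)).eq
      rw [hcomm]
      have := hsymm k (cfc (fun t : ℝ => f t) A x)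
      simp only [ContinuousLinearMap.coe_coe] at this
      rw [← this, hk', inner_zero_left]
    have e1 : inner ℂ k z = inner ℂ k (z - cfc (fun t : ℝ => f t) A (A x)) := by
      rw [inner_sub_right, e0, sub_zero]
    rw [e1, zero_add]
    refine (norm_inner_le_norm _ _).trans ?_
    rw [norm_sub_rev]
    calc ‖k‖ * _ ≤ ‖k‖ * (ε / (‖k‖ + 1)) := by gcongr
      _ = ‖k‖ / (‖k‖ + 1) * ε := by ring
      _ ≤ 1 * ε := by
        gcongr
        exact (div_le_one (by positivity)).2 (by linarith)
      _ = ε := one_mul ε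
  have hAz : A z = A x := by
    refine eq_of_forall_dist_le fun ε hε => ?_
    obtain ⟨f, hf, hfz⟩ := hz.2 (ε / (2 * ‖A‖ + 1)) (by positivity)
    set η := ε / (2 * ‖A‖ + 1)
    have hη : 0 < η := by positivity
    have hfc := f.continuous
    have e1 : A (cfc (fun t : ℝ => f t) A (A x)) - A x
        = cfc (fun t : ℝ => t * f t - 1) A (A x) := by
      rw [cfc_sub (a := A) (fun t : ℝ => t * f t) (fun _ => 1), cfc_const_one ℝ A,
        cfc_mul (a := A) (fun t : ℝ => t) (fun t => f t), cfc_id' ℝ A]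
      rfl
    have e2 : ‖A (cfc (fun t : ℝ => f t) A (A x)) - A x‖ ≤ ‖A‖ * η := by
      rw [e1, ← ENNReal.ofReal_le_ofReal_iff (by positivity),
        ← eLpNorm_spectralMeasure_of_continuous A (A x) (by fun_prop)]
      have : eLpNorm (fun t => t * f t - 1) 2 (spectralMeasure A (A x))
          ≤ ENNReal.ofReal ‖A‖ * eLpNorm (fun t => t⁻¹ - f t) 2 (spectralMeasure A (A x)) := by
        refine eLpNorm_le_mul_eLpNorm_of_ae_le_mul ?_ 2
        filter_upwards [hzero, ae_mem_Icc_norm A (A x)] with t h0 ht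
        have : t * f t - 1 = - (t * (t⁻¹ - f t)) := by field_simp; ring
        rw [this, norm_neg, norm_mul]
        gcongr
        exact abs_le.2 ht
      refine this.trans ?_
      rw [ENNReal.ofReal_mul (norm_nonneg _)]
      gcongr
    have e3 : ‖A z - A (cfc (fun t : ℝ => f t) A (A x))‖ ≤ ‖A‖ * η := by
      rw [← map_sub]
      refine (A.le_opNorm _).trans ?_
      rw [norm_sub_rev]
      gcongr
    rw [dist_eq_norm]
    calc _ ≤ _ := norm_sub_le_norm_sub_add_norm_sub _ (A (cfc (fun t : ℝ => f t) A (A x))) _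
      _ ≤ ‖A‖ * η + ‖A‖ * η := add_le_add e3 e2
      _ = (2 * ‖A‖) / (2 * ‖A‖ + 1) * ε := by simp only [η]; ring
      _ ≤ 1 * ε := by
        gcongr
        exact (div_le_one (by positivity)).2 (by linarith)
      _ = ε := one_mul ε
  have hxz : x - z ∈ A.ker := by
    simp [LinearMap.mem_ker, hAz]
  have hP : A.ker.starProjection x = x - z := by
    have e1 : A.ker.starProjection z = 0 :=
      (Submodule.starProjection_apply_eq_zero_iff _).2 horth
    have e2 : A.ker.starProjection (x - z) = x - z := Submodule.starProjection_eq_self_iff.2 hxz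
    rw [← e2, map_sub, e1, sub_zero]
  rw [hP, sub_sub_cancel]
  exact hz

end SpectralMeasure

/-! ### Divided differences of commuting self-adjoint operators -/

section DividedDifference
variable {q q' F : ℝ → ℝ}

/-- The mean of `q` over the segment from `Im z` to `Re z`. If `q = F'`, this is the divided
difference `(F(x) - F(y)) / (x - y)` at `x = Re z`, `y = Im z`, extended continuously by `F'(x)`
to the diagonal. -/
noncomputable def segmentMean (q : ℝ → ℝ) (z : ℂ) : ℝ :=
  ∫ s in (0 : ℝ)..1, q (z.im + s * (z.re - z.im))

theorem continuous_segmentMean (hq : Continuous q) : Continuous (segmentMean q) := by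
  unfold segmentMean
  exact intervalIntegral.continuous_parametric_intervalIntegral_of_continuous' (by fun_prop) 0 1

theorem sub_mul_segmentMean (hq : Continuous q) (hF : ∀ t, HasDerivAt F (q t) t) (z : ℂ) :
    (z.re - z.im) * segmentMean q z = F z.re - F z.im := by
  have h : ∀ s ∈ Set.uIcc (0 : ℝ) 1, HasDerivAt (fun s => F (z.im + s * (z.re - z.im)))
      ((z.re - z.im) * q (z.im + s * (z.re - z.im))) s := by
    intro s _
    have h1 : HasDerivAt (fun s : ℝ => z.im + s * (z.re - z.im)) (z.re - z.im) s := by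
      simpa using ((hasDerivAt_id s).mul_const (z.re - z.im)).const_add z.im
    have := (hF (z.im + s * (z.re - z.im))).comp s h1
    rwa [mul_comm] at this
  have := intervalIntegral.integral_eq_sub_of_hasDerivAt h
    (Continuous.intervalIntegrable (by fun_prop) _ _)
  rw [segmentMean, ← intervalIntegral.integral_const_mul, this]
  simp

theorem segmentMean_pos (hq : Continuous q) (hpos : ∀ t, 0 < q t) (z : ℂ) :
    0 < segmentMean q z :=
  intervalIntegral.intervalIntegral_pos_of_pos (Continuous.intervalIntegrable (by fun_prop) _ _)
    (fun _ => hpos _) one_pos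

theorem abs_segmentMean_le {z : ℂ} {c R : ℝ} (hz : ‖z‖ ≤ R)
    (h : ∀ t ∈ Set.Icc (-R) R, |q t| ≤ c) : |segmentMean q z| ≤ c := by
  have h1 := abs_le.1 ((Complex.abs_re_le_norm z).trans hz)
  have h2 := abs_le.1 ((Complex.abs_im_le_norm z).trans hz)
  have := intervalIntegral.norm_integral_le_of_norm_le_const (a := (0 : ℝ)) (b := 1) (C := c)
    (f := fun s => q (z.im + s * (z.re - z.im))) (fun s hs => by
      rw [Set.uIoc_of_le zero_le_one] at hs
      refine h _ ⟨?_, ?_⟩ <;> nlinarith [hs.1, hs.2])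
  simpa [segmentMean] using this

theorem segmentMean_sub (hq : Continuous q) (hq' : Continuous q') (z : ℂ) :
    segmentMean (fun t => q t - q' t) z = segmentMean q z - segmentMean q' z :=
  intervalIntegral.integral_sub (Continuous.intervalIntegrable (by fun_prop) _ _)
    (Continuous.intervalIntegrable (by fun_prop) _ _)

theorem segmentMean_add (hq : Continuous q) (hq' : Continuous q') (z : ℂ) :
    segmentMean (fun t => q t + q' t) z = segmentMean q z + segmentMean q' z :=
  intervalIntegral.integral_add (Continuous.intervalIntegrable (by fun_prop) _ _)
    (Continuous.intervalIntegrable (by fun_prop) _ _)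

theorem segmentMean_const_mul (c : ℝ) (q : ℝ → ℝ) (z : ℂ) :
    segmentMean (fun t => c * q t) z = c * segmentMean q z :=
  intervalIntegral.integral_const_mul _ _

/-- The divided difference of `t ↦ t ^ (n + 1)` is `x · (divided difference of t ^ n) + y ^ n`. -/
theorem segmentMean_pow_succ (n : ℕ) (z : ℂ) :
    segmentMean (fun t => (n + 1 : ℝ) * t ^ n) z
      = z.re * segmentMean (fun t => (n : ℝ) * t ^ (n - 1)) z + z.im ^ n := by
  have h1 := sub_mul_segmentMean (q := fun t => (n + 1 : ℝ) * t ^ n) (F := fun t => t ^ (n + 1))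
    (by fun_prop) (fun t => by simpa using hasDerivAt_pow (n + 1) t) z
  have h2 := sub_mul_segmentMean (q := fun t => (n : ℝ) * t ^ (n - 1)) (F := fun t => t ^ n)
    (by fun_prop) (fun t => by simpa using hasDerivAt_pow n t) z
  -- Off the diagonal one divides by `Re z - Im z`; on it the mean is that of a constant.
  rcases eq_or_ne z.re z.im with h | h
  · simp only [segmentMean, h, sub_self, mul_zero, add_zero, intervalIntegral.integral_const,
      sub_zero, one_smul]
    rcases n with - | n
    · simp
    · simp only [Nat.add_sub_cancel]; push_cast; ring
  · refine mul_left_cancel₀ (sub_ne_zero.2 h) ?_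
    linear_combination h1 - z.re * h2

end DividedDifference

section JointCalculus
variable {K : Type*} [NormedAddCommGroup K] [InnerProductSpace ℂ K] [CompleteSpace K]
  {a b : K →L[ℂ] K} {q q' F : ℝ → ℝ}

/-- For commuting self-adjoint operators `a` and `b`, the operator obtained by inserting `(a, b)`
into the divided difference `(F(x) - F(y)) / (x - y)` of a function `F` with derivative `q`. It is
defined by the continuous functional calculus of the normal operator `a + i b`. -/
noncomputable def dividedDifference (q : ℝ → ℝ) (a b : K →L[ℂ] K) : K →L[ℂ] K :=
  cfc (fun z : ℂ => (segmentMean q z : ℂ)) (a + Complex.I • b)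

theorem isStarNormal_add_I_smul (ha : IsSelfAdjoint a) (hb : IsSelfAdjoint b)
    (hab : Commute a b) : IsStarNormal (a + Complex.I • b) := by
  refine ⟨?_⟩
  have hab' := hab.eq
  rw [commute_iff_eq]
  simp only [star_add, star_smul, ha.star_eq, hb.star_eq, RCLike.star_def, Complex.conj_I,
    add_mul, mul_add, neg_smul, neg_mul, mul_neg, smul_mul_assoc, mul_smul_comm, hab']
  module

theorem realPart_add_I_smul (ha : IsSelfAdjoint a) (hb : IsSelfAdjoint b) :
    (realPart (a + Complex.I • b) : K →L[ℂ] K) = a := by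
  rw [realPart_apply_coe]
  simp only [star_add, star_smul, ha.star_eq, hb.star_eq, RCLike.star_def, Complex.conj_I]
  rw [neg_smul, add_add_add_comm, add_neg_cancel, add_zero, ← two_smul ℝ a, smul_smul]
  norm_num

theorem imaginaryPart_add_I_smul (ha : IsSelfAdjoint a) (hb : IsSelfAdjoint b) :
    (imaginaryPart (a + Complex.I • b) : K →L[ℂ] K) = b := by
  have h := realPart_add_I_smul_imaginaryPart (a + Complex.I • b)
  rw [realPart_add_I_smul ha hb] at h
  exact smul_right_injective _ Complex.I_ne_zero (add_left_cancel h)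

theorem cfc_re_add_I_smul (ha : IsSelfAdjoint a) (hb : IsSelfAdjoint b) (hab : Commute a b)
    (hF : Continuous F) :
    cfc (fun z : ℂ => (F z.re : ℂ)) (a + Complex.I • b) = cfc F a := by
  have := isStarNormal_add_I_smul ha hb hab
  rw [cfc_comp_re F _ hF.continuousOn, realPart_add_I_smul ha hb]

theorem cfc_im_add_I_smul (ha : IsSelfAdjoint a) (hb : IsSelfAdjoint b) (hab : Commute a b)
    (hF : Continuous F) :
    cfc (fun z : ℂ => (F z.im : ℂ)) (a + Complex.I • b) = cfc F b := by
  have := isStarNormal_add_I_smul ha hb hab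
  rw [cfc_comp_im F _ hF.continuousOn, imaginaryPart_add_I_smul ha hb]

theorem cfc_re_id_add_I_smul (ha : IsSelfAdjoint a) (hb : IsSelfAdjoint b) (hab : Commute a b) :
    cfc (fun z : ℂ => (z.re : ℂ)) (a + Complex.I • b) = a := by
  rw [cfc_re_add_I_smul ha hb hab continuous_id', cfc_id' ℝ a]

theorem cfc_im_id_add_I_smul (ha : IsSelfAdjoint a) (hb : IsSelfAdjoint b) (hab : Commute a b) :
    cfc (fun z : ℂ => (z.im : ℂ)) (a + Complex.I • b) = b := by
  rw [cfc_im_add_I_smul ha hb hab continuous_id', cfc_id' ℝ b]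

/-- `(a - b) D = F(a) - F(b)` for the divided difference `D` of `F` at `(a, b)`. -/
theorem sub_mul_dividedDifference (ha : IsSelfAdjoint a) (hb : IsSelfAdjoint b)
    (hab : Commute a b) (hq : Continuous q) (hF : ∀ t, HasDerivAt F (q t) t) :
    (a - b) * dividedDifference q a b = cfc F a - cfc F b := by
  have hN := isStarNormal_add_I_smul ha hb hab
  have hFc : Continuous F := continuous_iff_continuousAt.2 fun t => (hF t).continuousAt
  have hc := continuous_segmentMean hq
  have e : a - b = cfc (fun z : ℂ => (z.re : ℂ) - (z.im : ℂ)) (a + Complex.I • b) := by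
    rw [cfc_sub (a := a + Complex.I • b) (fun z : ℂ => (z.re : ℂ)) (fun z : ℂ => (z.im : ℂ)),
      cfc_re_id_add_I_smul ha hb hab, cfc_im_id_add_I_smul ha hb hab]
  rw [← cfc_re_add_I_smul ha hb hab hFc, ← cfc_im_add_I_smul ha hb hab hFc, e, dividedDifference,
    ← cfc_mul (a := a + Complex.I • b) (fun z : ℂ => (z.re : ℂ) - (z.im : ℂ))
      (fun z : ℂ => (segmentMean q z : ℂ)),
    ← cfc_sub (a := a + Complex.I • b) (fun z : ℂ => (F z.re : ℂ)) (fun z : ℂ => (F z.im : ℂ))]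
  congr 1
  ext z
  exact_mod_cast congrArg (fun t : ℝ => (t : ℂ)) (sub_mul_segmentMean hq hF z)

theorem norm_dividedDifference_sub_le (hq : Continuous q) (hq' : Continuous q') {c R : ℝ}
    (hc : 0 ≤ c) (hR : ‖a + Complex.I • b‖ ≤ R) (h : ∀ t ∈ Set.Icc (-R) R, |q t - q' t| ≤ c) :
    ‖dividedDifference q a b - dividedDifference q' a b‖ ≤ c := by
  have h1 := continuous_segmentMean hq
  have h2 := continuous_segmentMean hq'
  rw [dividedDifference, dividedDifference,
    ← cfc_sub (a := a + Complex.I • b) (fun z : ℂ => (segmentMean q z : ℂ))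
      (fun z : ℂ => (segmentMean q' z : ℂ))]
  refine norm_cfc_le hc fun z hz => ?_
  rw [← Complex.ofReal_sub, ← segmentMean_sub hq hq', Complex.norm_real]
  refine abs_segmentMean_le (R := R) (le_trans ?_ hR) h
  have hz' := spectrum.norm_le_norm_mul_of_mem hz
  have h1 : ‖(1 : K →L[ℂ] K)‖ ≤ 1 := ContinuousLinearMap.norm_id_le
  exact hz'.trans (mul_le_of_le_one_right (norm_nonneg _) h1)

theorem norm_dividedDifference_le {c : ℝ} (h : ∀ t, |q t| ≤ c) :
    ‖dividedDifference q a b‖ ≤ c :=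
  norm_cfc_le ((abs_nonneg _).trans (h 0)) fun z _ => by
    rw [Complex.norm_real]
    exact abs_segmentMean_le (R := ‖z‖) le_rfl fun t _ => h t

theorem dividedDifference_add (hq : Continuous q) (hq' : Continuous q') :
    dividedDifference (fun t => q t + q' t) a b
      = dividedDifference q a b + dividedDifference q' a b := by
  have h1 := continuous_segmentMean hq
  have h2 := continuous_segmentMean hq'
  simp only [dividedDifference, segmentMean_add hq hq', Complex.ofReal_add]
  exact cfc_add (a := a + Complex.I • b) (fun z : ℂ => (segmentMean q z : ℂ))
      (fun z : ℂ => (segmentMean q' z : ℂ))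

theorem dividedDifference_const_mul (c : ℝ) (hq : Continuous q) :
    dividedDifference (fun t => c * q t) a b = (c : ℂ) • dividedDifference q a b := by
  have h1 := continuous_segmentMean hq
  simp only [dividedDifference, segmentMean_const_mul, Complex.ofReal_mul]
  exact cfc_const_mul (c : ℂ) (fun z : ℂ => (segmentMean q z : ℂ)) (a + Complex.I • b)

theorem dividedDifference_pow_succ (ha : IsSelfAdjoint a) (hb : IsSelfAdjoint b)
    (hab : Commute a b) (n : ℕ) :
    dividedDifference (fun t => (n + 1 : ℝ) * t ^ n) a b
      = a * dividedDifference (fun t => (n : ℝ) * t ^ (n - 1)) a b + b ^ n := by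
  have hN := isStarNormal_add_I_smul ha hb hab
  have h1 : Continuous (segmentMean fun t => (n : ℝ) * t ^ (n - 1)) :=
    continuous_segmentMean (by fun_prop)
  have e1 : b ^ n = cfc (fun z : ℂ => (z.im : ℂ) ^ n) (a + Complex.I • b) := by
    rw [cfc_pow (fun z : ℂ => (z.im : ℂ)) n (a + Complex.I • b), cfc_im_id_add_I_smul ha hb hab]
  simp only [dividedDifference, segmentMean_pow_succ, Complex.ofReal_add, Complex.ofReal_mul,
    Complex.ofReal_pow]
  rw [e1, cfc_add (a := a + Complex.I • b)
      (fun z : ℂ => (z.re : ℂ) * (segmentMean (fun t => (n : ℝ) * t ^ (n - 1)) z : ℂ))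
      (fun z : ℂ => (z.im : ℂ) ^ n),
    cfc_mul (a := a + Complex.I • b) (fun z : ℂ => (z.re : ℂ))
      (fun z : ℂ => (segmentMean (fun t => (n : ℝ) * t ^ (n - 1)) z : ℂ)),
    cfc_re_id_add_I_smul ha hb hab]

open scoped ComplexOrder in
/-- If `q > 0`, the operator `dividedDifference q a b` has a positive injective square root, which
commutes with `a - b`. -/
theorem exists_sqrt_dividedDifference (ha : IsSelfAdjoint a) (hb : IsSelfAdjoint b)
    (hab : Commute a b) (hq : Continuous q) (hpos : ∀ t, 0 < q t) :
    ∃ S : K →L[ℂ] K, 0 ≤ S ∧ Commute (a - b) S ∧ Function.Injective S ∧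
      S * S = dividedDifference q a b := by
  have hN := isStarNormal_add_I_smul ha hb hab
  have hc := continuous_segmentMean hq
  have hsp : ∀ z, 0 < √(segmentMean q z) := fun z => Real.sqrt_pos.2 (segmentMean_pos hq hpos z)
  have hc1 : Continuous fun z : ℂ => (√(segmentMean q z) : ℂ) := by fun_prop
  have hc2 : Continuous fun z : ℂ => (√(segmentMean q z) : ℂ)⁻¹ :=
    hc1.inv₀ fun z => Complex.ofReal_ne_zero.2 (hsp z).ne'
  refine ⟨cfc (fun z : ℂ => (√(segmentMean q z) : ℂ)) (a + Complex.I • b), ?_, ?_, ?_, ?_⟩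
  · exact cfc_nonneg fun z _ => Complex.zero_le_real.2 (hsp z).le
  · have h1 := cfc_commute_cfc (fun z : ℂ => (z.re : ℂ)) (fun z : ℂ => (√(segmentMean q z) : ℂ))
      (a + Complex.I • b)
    have h2 := cfc_commute_cfc (fun z : ℂ => (z.im : ℂ)) (fun z : ℂ => (√(segmentMean q z) : ℂ))
      (a + Complex.I • b)
    rw [cfc_re_id_add_I_smul ha hb hab] at h1
    rw [cfc_im_id_add_I_smul ha hb hab] at h2
    exact h1.sub_left h2
  · have h : cfc (fun z : ℂ => (√(segmentMean q z) : ℂ)⁻¹) (a + Complex.I • b)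
        * cfc (fun z : ℂ => (√(segmentMean q z) : ℂ)) (a + Complex.I • b) = 1 := by
      rw [← cfc_mul (a := a + Complex.I • b) (fun z : ℂ => (√(segmentMean q z) : ℂ)⁻¹)
        (fun z : ℂ => (√(segmentMean q z) : ℂ)) hc2.continuousOn hc1.continuousOn,
        ← cfc_const_one ℂ (a + Complex.I • b)]
      congr 1
      ext z
      exact inv_mul_cancel₀ (Complex.ofReal_ne_zero.2 (hsp z).ne')
    exact Function.LeftInverse.injective fun x => congrArg (fun B : K →L[ℂ] K => B x) h
  · rw [dividedDifference, ← cfc_mul (a := a + Complex.I • b)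
      (fun z : ℂ => (√(segmentMean q z) : ℂ)) (fun z : ℂ => (√(segmentMean q z) : ℂ))
        hc1.continuousOn hc1.continuousOn]
    congr 1
    ext z
    rw [← Complex.ofReal_mul, Real.mul_self_sqrt (segmentMean_pos hq hpos z).le]

end JointCalculus

/-! ### The Hilbert space of covariant operators -/

theorem integrable_inner_of_memLp {Ω E : Type*} [MeasurableSpace Ω] {P : Measure Ω}
    [NormedAddCommGroup E] [InnerProductSpace ℂ E] {f g : Ω → E} (hf : MemLp f 2 P)
    (hg : MemLp g 2 P) : Integrable (fun ω => inner ℂ (f ω) (g ω)) P := by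
  refine (L2.integrable_inner (𝕜 := ℂ) hf.toLp hg.toLp).congr ?_
  filter_upwards [hf.coeFn_toLp, hg.coeFn_toLp] with ω h1 h2
  rw [h1, h2]

section LatticeOperators
variable {d : ℕ}

theorem shift_zero_apply (φ : L2 d) : shift 0 φ = φ := by
  ext x
  rw [shift_apply, sub_zero]

theorem inner_shift_shift (a : Lattice d) (φ ψ : L2 d) :
    inner ℂ (shift a φ) (shift a ψ) = inner ℂ φ ψ :=
  (⟨(shift a : L2 d →L[ℂ] L2 d).toLinearMap, norm_shift_apply a⟩ :
    L2 d →ₗᵢ[ℂ] L2 d).inner_map_map φ ψ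

theorem inner_shift_left (a : Lattice d) (φ ψ : L2 d) :
    inner ℂ (shift a φ) ψ = inner ℂ φ (shift (-a) ψ) := by
  rw [← inner_shift_shift a φ, shift_shift, add_neg_cancel, shift_zero_apply]

theorem isSelfAdjoint_laplacian : IsSelfAdjoint (laplacian (d := d)) := by
  rw [ContinuousLinearMap.isSelfAdjoint_iff_isSymmetric]
  intro φ ψ
  simp only [laplacian, ContinuousLinearMap.coe_coe, neg_apply, sum_apply, add_apply,
    inner_neg_left, inner_neg_right, sum_inner, inner_sum, inner_add_left, inner_add_right,
    inner_shift_left, neg_neg]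
  congr 1
  exact Finset.sum_congr rfl fun j _ => add_comm _ _

theorem isSelfAdjoint_mulOp (v : Lattice d → ℝ) : IsSelfAdjoint (mulOp v) := by
  by_cases h : ∃ C, ∀ x, |v x| ≤ C
  · rw [ContinuousLinearMap.isSelfAdjoint_iff_isSymmetric]
    intro φ ψ
    rw [lp.inner_eq_tsum, lp.inner_eq_tsum]
    refine tsum_congr fun x => ?_
    simp only [ContinuousLinearMap.coe_coe, mulOp_apply h, RCLike.inner_apply, map_mul,
      Complex.conj_ofReal]
    ring
  · rw [mulOp, dif_neg h]
    exact IsSelfAdjoint.zero _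

theorem incl_apply (φ : Fin2 d) (x : Lattice d) : incl φ x = φ x := by
  induction φ using Finsupp.induction_linear with
  | zero => simp
  | add f g hf hg => simp [hf, hg]
  | single y c =>
    rw [incl_single, lp.coeFn_smul, Pi.smul_apply, delta, lp.single_apply]
    by_cases h : x = y
    · subst h; simp
    · simp [h]

theorem mulFin_apply (v : Lattice d → ℝ) (φ : Fin2 d) (x : Lattice d) :
    mulFin v φ x = v x * φ x := by
  induction φ using Finsupp.induction_linear with
  | zero => simp
  | add f g hf hg => simp [hf, hg, mul_add]
  | single y c =>
    rw [mulFin_single]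
    by_cases h : y = x
    · subst h; simp
    · simp [h]

theorem incl_shiftFin (a : Lattice d) (φ : Fin2 d) : incl (shiftFin a φ) = shift a (incl φ) := by
  induction φ using Finsupp.induction_linear with
  | zero => simp
  | add f g hf hg => simp [hf, hg]
  | single y c =>
    rw [shiftFin_single, incl_single, incl_single, map_smul]
    congr 1
    ext x
    simp [shift_apply, delta, lp.single_apply, Pi.single_apply, sub_eq_iff_eq_add]

end LatticeOperators

namespace AndersonModel
variable {d : ℕ} {Ω : Type*} [MeasurableSpace Ω] {P : Measure Ω} (M : AndersonModel d Ω P)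

theorem integral_comp_τ (a : Lattice d) {f : Ω → ℂ} (hf : AEStronglyMeasurable f P) :
    ∫ ω, f (M.τ a ω) ∂P = ∫ ω, f ω ∂P := by
  have hτ := M.measurePreserving_τ a
  rw [← hτ.map_eq] at hf
  rw [← integral_map hτ.measurable.aemeasurable hf, hτ.map_eq]

theorem isSelfAdjoint_ham (ω : Ω) : IsSelfAdjoint (M.ham ω) :=
  isSelfAdjoint_laplacian.neg.add (isSelfAdjoint_mulOp _)

theorem leftMul_mk (A : M.PreK2) : M.leftMul (SeparationQuotient.mk A)
    = SeparationQuotient.mk (X := M.PreK2) ⟨_, M.leftMul_mem A⟩ := rfl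

theorem rightMul_mk (A : M.PreK2) : M.rightMul (SeparationQuotient.mk A)
    = SeparationQuotient.mk (X := M.PreK2) ⟨_, M.rightMul_mem A⟩ := rfl

theorem commute_leftMul_rightMul : Commute M.leftMul M.rightMul := by
  refine ContinuousLinearMap.ext fun x => ?_
  obtain ⟨A, rfl⟩ := SeparationQuotient.surjective_mk x
  rfl

theorem isSelfAdjoint_leftMul : IsSelfAdjoint M.leftMul := by
  rw [ContinuousLinearMap.isSelfAdjoint_iff_isSymmetric]
  intro x y
  obtain ⟨A, rfl⟩ := SeparationQuotient.surjective_mk x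
  obtain ⟨B, rfl⟩ := SeparationQuotient.surjective_mk y
  change ∫ ω, inner ℂ (M.ham ω (A.1 ω (Finsupp.single 0 1))) (B.1 ω (Finsupp.single 0 1)) ∂P
    = ∫ ω, inner ℂ (A.1 ω (Finsupp.single 0 1)) (M.ham ω (B.1 ω (Finsupp.single 0 1))) ∂P
  refine integral_congr_ae (ae_of_all _ fun ω => ?_)
  exact ContinuousLinearMap.isSelfAdjoint_iff_isSymmetric.1 (M.isSelfAdjoint_ham ω) _ _

/-- Covariance moves the columns of two covariant operators:
`E ⟨A δ_a, B δ_0⟩ = E ⟨A δ_0, B δ_{-a}⟩`. -/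
theorem integral_inner_column (A B : M.PreK2) (a : Lattice d) :
    ∫ ω, inner ℂ (A.1 ω (Finsupp.single a 1)) (B.1 ω (Finsupp.single 0 1)) ∂P
      = ∫ ω, inner ℂ (A.1 ω (Finsupp.single 0 1)) (B.1 ω (Finsupp.single (-a) 1)) ∂P := by
  rw [← M.integral_comp_τ a (f := fun ω => inner ℂ (A.1 ω (Finsupp.single a 1))
    (B.1 ω (Finsupp.single 0 1))) ((A.2.1 a).inner (B.2.1 0))]
  refine integral_congr_ae ?_
  filter_upwards [A.2.2.1 a, B.2.2.1 a] with ω e1 e2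
  have e3 := e1 (Finsupp.single 0 1)
  have e4 := e2 (Finsupp.single (-a) 1)
  rw [shiftFin_single, zero_add] at e3
  rw [shiftFin_single, neg_add_cancel] at e4
  rw [e3, e4, inner_shift_shift]

/-- Right multiplication is symmetric because covariance turns the columns `A δ_{± e_j}` paired with
`B δ_0` into `A δ_0` paired with `B δ_{∓ e_j}`. -/
theorem isSelfAdjoint_rightMul : IsSelfAdjoint M.rightMul := by
  rw [ContinuousLinearMap.isSelfAdjoint_iff_isSymmetric]
  intro x y
  obtain ⟨A, rfl⟩ := SeparationQuotient.surjective_mk x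
  obtain ⟨B, rfl⟩ := SeparationQuotient.surjective_mk y
  change ∫ ω, inner ℂ (A.1 ω (M.hamFin ω (Finsupp.single 0 1))) (B.1 ω (Finsupp.single 0 1)) ∂P
    = ∫ ω, inner ℂ (A.1 ω (Finsupp.single 0 1)) (B.1 ω (M.hamFin ω (Finsupp.single 0 1))) ∂P
  simp only [rightMul_apply, zero_add, zero_sub]
  have hi : ∀ a, Integrable (fun ω => inner ℂ (A.1 ω (Finsupp.single a 1))
      (B.1 ω (Finsupp.single 0 1))) P := fun a =>
    integrable_inner_of_memLp (M.memLp_column A a) (M.memLp_column B 0)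
  have hi' : ∀ a, Integrable (fun ω => inner ℂ (A.1 ω (Finsupp.single 0 1))
      (B.1 ω (Finsupp.single a 1))) P := fun a =>
    integrable_inner_of_memLp (M.memLp_column A 0) (M.memLp_column B a)
  have hV : Integrable (fun ω => inner ℂ ((M.V ω 0 : ℂ) • A.1 ω (Finsupp.single 0 1))
      (B.1 ω (Finsupp.single 0 1))) P :=
    integrable_inner_of_memLp (M.memLp_potential_smul A 0) (M.memLp_column B 0)
  have hV' : Integrable (fun ω => inner ℂ (A.1 ω (Finsupp.single 0 1))
      ((M.V ω 0 : ℂ) • B.1 ω (Finsupp.single 0 1))) P :=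
    integrable_inner_of_memLp (M.memLp_column A 0) (M.memLp_potential_smul B 0)
  have hj : ∀ j : Fin d, Integrable (fun ω =>
      inner ℂ (A.1 ω (Finsupp.single (Pi.single j 1) 1)) (B.1 ω (Finsupp.single 0 1))
      + inner ℂ (A.1 ω (Finsupp.single (-Pi.single j 1) 1)) (B.1 ω (Finsupp.single 0 1))) P :=
    fun j => (hi _).add (hi _)
  have hj' : ∀ j : Fin d, Integrable (fun ω =>
      inner ℂ (A.1 ω (Finsupp.single 0 1)) (B.1 ω (Finsupp.single (Pi.single j 1) 1))
      + inner ℂ (A.1 ω (Finsupp.single 0 1)) (B.1 ω (Finsupp.single (-Pi.single j 1) 1))) P :=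
    fun j => (hi' _).add (hi' _)
  simp only [inner_add_left, inner_add_right, sum_inner, inner_sum]
  rw [integral_add (integrable_finsetSum _ fun j _ => hj j) hV,
    integral_add (integrable_finsetSum _ fun j _ => hj' j) hV',
    integral_finsetSum _ fun j _ => hj j, integral_finsetSum _ fun j _ => hj' j]
  congr 1
  · refine Finset.sum_congr rfl fun j _ => ?_
    rw [integral_add (hi _) (hi _), integral_add (hi' _) (hi' _), integral_inner_column,
      integral_inner_column, neg_neg, add_comm]
  · refine integral_congr_ae (ae_of_all _ fun ω => ?_)
    simp only [inner_smul_left, inner_smul_right, Complex.conj_ofReal]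

theorem isSelfAdjoint_liouvillian : IsSelfAdjoint M.liouvillian :=
  M.isSelfAdjoint_leftMul.sub M.isSelfAdjoint_rightMul

/-- The element `x` of `𝒦₂` is represented by the family `F`: some representative of `x` agrees
with `F` almost surely. -/
def Represents (F : Ω → (Fin2 d →ₗ[ℂ] L2 d)) (x : M.K2) : Prop :=
  ∃ A : M.PreK2, SeparationQuotient.mk A = x ∧ ∀ᵐ ω ∂P, A.1 ω = F ω

variable {M} in
theorem exists_represents (x : M.K2) : ∃ F, M.Represents F x := by
  obtain ⟨A, rfl⟩ := SeparationQuotient.surjective_mk x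
  exact ⟨A.1, A, rfl, ae_of_all _ fun _ => rfl⟩

section Represents
variable {M} {F G : Ω → (Fin2 d →ₗ[ℂ] L2 d)} {x y : M.K2}

theorem represents_mk (h : F ∈ M.covariantOperators) :
    M.Represents F (SeparationQuotient.mk (X := M.PreK2) ⟨F, h⟩) :=
  ⟨_, rfl, ae_of_all _ fun _ => rfl⟩

theorem Represents.congr (h : M.Represents F x) (hFG : ∀ᵐ ω ∂P, F ω = G ω) :
    M.Represents G x := by
  obtain ⟨A, hA, hAF⟩ := h
  refine ⟨A, hA, ?_⟩
  filter_upwards [hAF, hFG] with ω h1 h2 using h1.trans h2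

theorem represents_zero : M.Represents (fun _ => 0) (0 : M.K2) :=
  ⟨0, rfl, ae_of_all _ fun _ => rfl⟩

theorem Represents.add (hx : M.Represents F x) (hy : M.Represents G y) :
    M.Represents (fun ω => F ω + G ω) (x + y) := by
  obtain ⟨A, rfl, hA⟩ := hx
  obtain ⟨B, rfl, hB⟩ := hy
  refine ⟨A + B, rfl, ?_⟩
  filter_upwards [hA, hB] with ω h1 h2
  rw [← h1, ← h2]
  rfl

theorem Represents.smul (c : ℂ) (hx : M.Represents F x) :
    M.Represents (fun ω => c • F ω) (c • x) := by
  obtain ⟨A, rfl, hA⟩ := hx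
  refine ⟨c • A, rfl, ?_⟩
  filter_upwards [hA] with ω h1
  rw [← h1]
  rfl

theorem Represents.sub (hx : M.Represents F x) (hy : M.Represents G y) :
    M.Represents (fun ω => F ω - G ω) (x - y) := by
  obtain ⟨A, rfl, hA⟩ := hx
  obtain ⟨B, rfl, hB⟩ := hy
  refine ⟨A - B, rfl, ?_⟩
  filter_upwards [hA, hB] with ω h1 h2
  rw [← h1, ← h2]
  rfl

theorem Represents.leftMul (hx : M.Represents F x) :
    M.Represents (fun ω => (M.ham ω).toLinearMap ∘ₗ F ω) (M.leftMul x) := by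
  obtain ⟨A, rfl, hA⟩ := hx
  refine ⟨_, (M.leftMul_mk A).symm, ?_⟩
  filter_upwards [hA] with ω h1
  rw [← h1]

theorem Represents.rightMul (hx : M.Represents F x) :
    M.Represents (fun ω => F ω ∘ₗ M.hamFin ω) (M.rightMul x) := by
  obtain ⟨A, rfl, hA⟩ := hx
  refine ⟨_, (M.rightMul_mk A).symm, ?_⟩
  filter_upwards [hA] with ω h1
  rw [← h1]

theorem Represents.rightMul_pow (hx : M.Represents F x) (n : ℕ) :
    M.Represents (fun ω => F ω ∘ₗ (M.hamFin ω ^ n : Module.End ℂ (Fin2 d)))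
      ((M.rightMul ^ n) x) := by
  induction n with
  | zero => exact hx
  | succ n ih =>
    have e : (M.rightMul ^ (n + 1)) x = M.rightMul ((M.rightMul ^ n) x) := by
      rw [pow_succ']; rfl
    rw [e]
    refine ih.rightMul.congr (ae_of_all _ fun ω => ?_)
    rw [pow_succ]
    rfl

theorem Represents.mem (hx : M.Represents F x) : F ∈ M.covariantOperators := by
  obtain ⟨A, -, hA⟩ := hx
  have hA' : ∀ a, ∀ᵐ ω ∂P, A.1 ω (Finsupp.single a 1) = F ω (Finsupp.single a 1) := fun a => by
    filter_upwards [hA] with ω h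
    rw [h]
  refine ⟨fun a => (A.2.1 a).congr (hA' a), fun a => ?_, A.2.2.2.ae_eq (hA' 0)⟩
  filter_upwards [hA, (M.measurePreserving_τ a).quasiMeasurePreserving.ae hA, A.2.2.1 a]
    with ω h1 h2 h3
  rwa [← h1, ← h2]

theorem mk_eq_mk_iff_ae (A B : M.PreK2) :
    (SeparationQuotient.mk A : M.K2) = SeparationQuotient.mk B ↔ ∀ᵐ ω ∂P, A.1 ω = B.1 ω := by
  rw [SeparationQuotient.mk_eq_mk, Metric.inseparable_iff, dist_eq_norm, norm_eq_column,
    norm_eq_zero, column_eq_zero_iff]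
  refine eventually_congr (ae_of_all _ fun ω => ?_)
  exact sub_eq_zero

theorem Represents.toK2_eq (hx : M.Represents F x) : M.toK2 F = x := by
  rw [toK2, dif_pos hx.mem]
  obtain ⟨A, rfl, hA⟩ := hx
  refine (mk_eq_mk_iff_ae _ _).2 ?_
  filter_upwards [hA] with ω h using h.symm

theorem Represents.ae_eq_zero (hx : M.Represents F x) (h : x = 0) : ∀ᵐ ω ∂P, F ω = 0 := by
  obtain ⟨A, rfl, hA⟩ := hx
  have := (mk_eq_mk_iff_ae A 0).1 h
  filter_upwards [hA, this] with ω h1 h2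
  rw [← h1, h2]
  rfl

/-- Convergence in `𝒦₂` implies almost sure convergence of every column along a subsequence. -/
theorem Represents.exists_subseq_tendsto {Fn : ℕ → Ω → (Fin2 d →ₗ[ℂ] L2 d)} {xn : ℕ → M.K2}
    (hn : ∀ n, M.Represents (Fn n) (xn n)) (hx : M.Represents F x)
    (h : Tendsto xn atTop (𝓝 x)) (a : Lattice d) :
    ∃ ns : ℕ → ℕ, StrictMono ns ∧ ∀ᵐ ω ∂P, Tendsto
      (fun k => Fn (ns k) ω (Finsupp.single a 1)) atTop (𝓝 (F ω (Finsupp.single a 1))) := by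
  choose A hA hAF using hn
  obtain ⟨B, rfl, hB⟩ := hx
  have hnorm : ∀ n, eLpNorm ((fun ω => (A n).1 ω (Finsupp.single a 1))
      - fun ω => B.1 ω (Finsupp.single a 1)) 2 P
        = ENNReal.ofReal ‖xn n - SeparationQuotient.mk B‖ := by
    intro n
    have e : ‖xn n - SeparationQuotient.mk B‖ = ‖column (A n - B)‖ := by
      rw [← hA]; rfl
    rw [e, ← M.norm_column (A n - B) a, Lp.norm_toLp,
      ENNReal.ofReal_toReal (M.memLp_column (A n - B) a).2.ne]
    rfl
  have hm : TendstoInMeasure P (fun n ω => (A n).1 ω (Finsupp.single a 1)) atTop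
      fun ω => B.1 ω (Finsupp.single a 1) := by
    refine tendstoInMeasure_of_tendsto_eLpNorm (p := 2) (by norm_num) (fun n => (A n).2.1 a)
      (B.2.1 a) ?_
    simp only [hnorm]
    rw [← ENNReal.ofReal_zero]
    exact ENNReal.tendsto_ofReal (tendsto_iff_norm_sub_tendsto_zero.1 h)
  obtain ⟨ns, h1, h2⟩ := hm.exists_seq_tendsto_ae
  refine ⟨ns, h1, ?_⟩
  filter_upwards [h2, hB, ae_all_iff.2 hAF] with ω e1 e2 e3
  rw [← e2]
  simpa only [← e3] using e1

end Represents

end AndersonModel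

/-! ### The velocity operator and polynomial commutators -/

theorem functionOf_polynomial {K : Type*} [NormedAddCommGroup K] [InnerProductSpace ℂ K]
    [CompleteSpace K] {A : K →L[ℂ] K} (hA : IsSelfAdjoint A) (p : Polynomial ℝ) :
    functionOf (fun t => p.eval t) A = Polynomial.aeval A p :=
  cfc_polynomial p A

section LatticeOperators
variable {d : ℕ}

theorem incl_laplacianFin (φ : Fin2 d) : incl (laplacianFin φ) = laplacian (incl φ) := by
  simp [laplacianFin, laplacian, incl_shiftFin]

variable [NeZero d]

/-- `X₁ U(a) - U(a) X₁ = a₁ U(a)`. -/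
theorem posFin_shiftFin (a : Lattice d) (φ : Fin2 d) :
    posFin (shiftFin a φ) = shiftFin a (posFin φ) + ((a 0 : ℤ) : ℂ) • shiftFin a φ := by
  induction φ using Finsupp.induction_linear with
  | zero => simp
  | add f g hf hg => simp only [map_add, hf, hg, smul_add]; abel
  | single x c =>
    simp only [posFin, mulFin_single, shiftFin_single, Finsupp.smul_single, smul_eq_mul,
      ← Finsupp.single_add]
    congr 1
    push_cast [Pi.add_apply]
    ring

theorem incl_posFin_apply (φ : Fin2 d) (x : Lattice d) :
    incl (posFin φ) x = ((x 0 : ℤ) : ℂ) * incl φ x := by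
  rw [incl_apply, incl_apply, posFin, mulFin_apply]
  norm_cast

end LatticeOperators

namespace AndersonModel
variable {d : ℕ} {Ω : Type*} [MeasurableSpace Ω] {P : Measure Ω} (M : AndersonModel d Ω P)

variable {M} in
theorem represents_toK2 {F : Ω → (Fin2 d →ₗ[ℂ] L2 d)} (h : F ∈ M.covariantOperators) :
    M.Represents F (M.toK2 F) := by
  have := represents_mk h
  rwa [this.toK2_eq]

theorem ae_ham_incl : ∀ᵐ ω ∂P, ∀ φ, M.ham ω (incl φ) = incl (M.hamFin ω φ) := by
  obtain ⟨C, -, hC⟩ := M.exists_bound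
  filter_upwards [hC] with ω hω using M.ham_incl ⟨C, hω⟩

/-- The joint law of the potential at two sites is `ξ × ξ`, and the diagonal is a null set for it
because `ξ` has no atoms. -/
theorem ae_potential_ne {x y : Lattice d} (hxy : x ≠ y) [IsProbabilityMeasure P] :
    ∀ᵐ ω ∂P, M.V ω x ≠ M.V ω y := by
  have hm : Measurable fun ω => (M.V ω x, M.V ω y) := (M.measurable_V x).prodMk (M.measurable_V y)
  have hlaw := (indepFun_iff_map_prod_eq_prod_map_map (M.measurable_V x).aemeasurable
    (M.measurable_V y).aemeasurable).1 (M.indep.indepFun hxy)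
  have hprob : IsProbabilityMeasure M.ξ := by
    rw [← M.law x]
    exact Measure.isProbabilityMeasure_map (M.measurable_V x).aemeasurable
  rw [M.law, M.law] at hlaw
  have hatom : ∀ t, M.ξ {t} = 0 := by
    intro t
    obtain ⟨ρ, -, -, h⟩ := M.bounded_density
    rw [h]
    exact withDensity_absolutelyContinuous _ _ (measure_singleton t)
  have hs : MeasurableSet {z : ℝ × ℝ | z.1 = z.2} := measurableSet_eq_fun measurable_fst measurable_snd
  have h0 : (M.ξ.prod M.ξ) {z : ℝ × ℝ | z.1 = z.2} = 0 := by
    rw [Measure.measure_prod_null hs]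
    refine ae_of_all _ fun t => ?_
    have : Prod.mk t ⁻¹' {z : ℝ × ℝ | z.1 = z.2} = {t} := by
      ext s; simp [eq_comm]
    change M.ξ (Prod.mk t ⁻¹' {z : ℝ × ℝ | z.1 = z.2}) = 0
    rw [this]
    exact hatom t
  rw [← hlaw, Measure.map_apply hm hs] at h0
  rw [ae_iff]
  simpa using h0

open Polynomial in
theorem ae_functionOf_polynomial_incl : ∀ᵐ ω ∂P, ∀ (p : ℝ[X]) (φ : Fin2 d),
    incl (aeval (M.hamFin ω : Module.End ℂ (Fin2 d)) p φ)
      = functionOf (fun t => p.eval t) (M.ham ω) (incl φ) := by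
  filter_upwards [M.ae_ham_incl] with ω hω p φ
  rw [functionOf_polynomial (M.isSelfAdjoint_ham ω)]
  have hpow : ∀ (n : ℕ) (φ : Fin2 d), incl ((M.hamFin ω ^ n : Module.End ℂ (Fin2 d)) φ)
      = (M.ham ω ^ n) (incl φ) := by
    intro n
    induction n with
    | zero => intro φ; rfl
    | succ n ih =>
      intro φ
      rw [pow_succ, pow_succ, Module.End.mul_apply, ih, ← hω]
      rfl
  induction p using Polynomial.induction_on' with
  | add p r hp hr => simp only [map_add, LinearMap.add_apply, add_apply, hp, hr]
  | monomial n c =>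
    simp only [aeval_monomial, Algebra.algebraMap_eq_smul_one, smul_mul_assoc, one_mul,
      LinearMap.smul_apply, smul_apply, ← Complex.coe_smul, map_smul, hpow]

section Velocity
variable [NeZero d]

/-- The velocity operator is `-i (U(e₁) - U(-e₁))`; in particular it is deterministic. -/
theorem incl_hamFin_posFin_sub (ω : Ω) (φ : Fin2 d) :
    incl (M.hamFin ω (posFin φ) - posFin (M.hamFin ω φ))
      = shift (-Pi.single 0 1) (incl φ) - shift (Pi.single 0 1) (incl φ) := by
  have hc : mulFin (M.V ω) (posFin φ) = posFin (mulFin (M.V ω) φ) := by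
    ext x
    simp only [posFin, mulFin_apply]
    ring
  have h : M.hamFin ω (posFin φ) - posFin (M.hamFin ω φ)
      = ∑ j : Fin d, (((-((Pi.single j 1 : Lattice d) 0) : ℤ) : ℂ) •
          (shiftFin (Pi.single j 1) φ - shiftFin (-Pi.single j 1) φ)) := by
    simp only [hamFin, laplacianFin, neg_neg, LinearMap.neg_apply, LinearMap.add_apply, LinearMap.sum_apply, hc,
      map_add, map_sum, posFin_shiftFin, add_sub_add_right_eq_sub, ← Finset.sum_sub_distrib]
    refine Finset.sum_congr rfl fun (j : Fin d) _ => ?_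
    simp only [Pi.neg_apply, Int.cast_neg]
    module
  rw [h, Finset.sum_eq_single 0]
  · simp [incl_shiftFin]
  · intro j _ hj
    simp [Pi.single_eq_of_ne hj.symm]
  · simp

theorem velocityFamily_mem [IsFiniteMeasure P] :
    (fun ω => Complex.I • incl ∘ₗ (M.hamFin ω ∘ₗ posFin - posFin ∘ₗ M.hamFin ω))
      ∈ M.covariantOperators := by
  have h : ∀ (ω : Ω) (φ : Fin2 d),
      (Complex.I • incl ∘ₗ (M.hamFin ω ∘ₗ posFin - posFin ∘ₗ M.hamFin ω)) φ
        = Complex.I • (shift (-Pi.single 0 1) (incl φ) - shift (Pi.single 0 1) (incl φ)) :=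
    fun ω φ => by rw [← M.incl_hamFin_posFin_sub ω φ]; rfl
  refine ⟨fun a => ?_, fun a => ae_of_all _ fun ω φ => ?_, ?_⟩
  · simp only [h]
    exact aestronglyMeasurable_const
  · simp only [h, incl_shiftFin, map_smul, map_sub, shift_shift, add_comm a]
  · simp only [h]
    exact memLp_const _

theorem represents_velocity [IsFiniteMeasure P] : M.Represents
    (fun ω => Complex.I • incl ∘ₗ (M.hamFin ω ∘ₗ posFin - posFin ∘ₗ M.hamFin ω)) M.velocity :=
  represents_toK2 M.velocityFamily_mem

/-- The velocity operator does not commute with the Hamiltonian: the entry of `[H, Ẋ₁]` between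
the sites `0` and `e₁` is a nonzero multiple of `V(e₁) - V(0)`. -/
theorem liouvillian_velocity_ne_zero [IsProbabilityMeasure P] :
    M.liouvillian M.velocity ≠ 0 := by
  intro h
  have h1 := (M.represents_velocity.leftMul.sub M.represents_velocity.rightMul).ae_eq_zero h
  obtain ⟨C, -, hC⟩ := M.exists_bound
  have hne : (0 : Lattice d) ≠ Pi.single 0 1 := fun h => by simpa using congrFun h 0
  obtain ⟨ω, hω, hV, hω2⟩ := (h1.and ((M.ae_potential_ne hne).and hC)).exists
  have h2 := congrArg (fun B : Fin2 d →ₗ[ℂ] L2 d => B (Finsupp.single 0 1)) hω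
  have hv : ∀ φ, (Complex.I • incl ∘ₗ (M.hamFin ω ∘ₗ posFin - posFin ∘ₗ M.hamFin ω)) φ
      = Complex.I • (shift (-Pi.single 0 1) (incl φ) - shift (Pi.single 0 1) (incl φ)) :=
    fun φ => by rw [← M.incl_hamFin_posFin_sub ω φ]; rfl
  have hlap : laplacian (Complex.I • (shift (-Pi.single 0 1) (delta 0)
      - shift (Pi.single 0 1) (delta 0)))
      = Complex.I • (shift (-Pi.single 0 1) (laplacian (delta (0 : Lattice d)))
        - shift (Pi.single 0 1) (laplacian (delta 0))) := by
    simp only [map_smul, map_sub, laplacian_shift]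
  -- The Laplacian commutes with translations, hence with `Ẋ₁`; only the potential remains.
  have hd : delta (0 : Lattice d) (Pi.single 0 1 - -Pi.single 0 1) = 0 := by
    rw [delta, lp.single_apply_ne]
    intro h
    have := congrFun h 0
    simp at this
  have hd0 : delta (0 : Lattice d) (Pi.single 0 1 - Pi.single 0 1) = 1 := by
    rw [sub_self, delta, lp.single_apply_self]
  have h3 : M.hamFin ω (Finsupp.single 0 1)
      = -laplacianFin (Finsupp.single 0 1) + Finsupp.single 0 (M.V ω 0 : ℂ) := by
    rw [hamFin, LinearMap.add_apply, mulFin_single, mul_one]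
    rfl
  have hpot : incl (Finsupp.single 0 (M.V ω 0 : ℂ)) = (M.V ω 0 : ℂ) • delta (0 : Lattice d) := incl_single _ _
  have hdelta : incl (Finsupp.single 0 1) = delta (0 : Lattice d) := by
    rw [incl_single, one_smul]
  simp only [LinearMap.sub_apply, LinearMap.comp_apply, hv, h3, map_add, map_neg, hpot, hdelta,
    incl_laplacianFin, ContinuousLinearMap.coe_coe, ham, add_apply, neg_apply] at h2
  rw [hlap] at h2
  have h4 : mulOp (M.V ω) (Complex.I • (shift (-Pi.single 0 1) (delta 0)
      - shift (Pi.single 0 1) (delta 0))) = (M.V ω 0 : ℂ) •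
        (Complex.I • (shift (-Pi.single 0 1) (delta 0) - shift (Pi.single 0 1) (delta 0))) := by
    rw [← sub_eq_zero]
    simp only [LinearMap.zero_apply] at h2
    rw [← h2]
    simp only [map_smul]
    module
  have h5 := congrArg (fun ψ : L2 d => ψ (Pi.single 0 1)) h4
  simp only [mulOp_apply ⟨C, hω2⟩, lp.coeFn_smul, lp.coeFn_sub, Pi.smul_apply, Pi.sub_apply,
    shift_apply, hd, hd0, smul_eq_mul] at h5
  have h6 : (M.V ω (Pi.single 0 1) : ℂ) = (M.V ω 0 : ℂ) :=
    mul_right_cancel₀ (mul_ne_zero Complex.I_ne_zero (by norm_num : (0 - 1 : ℂ) ≠ 0)) h5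
  exact hV (Complex.ofReal_injective h6.symm)

end Velocity

section Polynomial
variable [NeZero d] [IsFiniteMeasure P]

/-- `i [X₁, H ^ n] = -D Ẋ₁` with `D` the divided difference of `t ^ n`, by the Leibniz rule
`[X₁, H ^ (n + 1)] = H [X₁, H ^ n] + [X₁, H] H ^ n`. -/
theorem represents_pow_commutator (n : ℕ) : M.Represents
    (fun ω => Complex.I • incl ∘ₗ (posFin ∘ₗ (M.hamFin ω ^ n : Module.End ℂ (Fin2 d))
      - (M.hamFin ω ^ n : Module.End ℂ (Fin2 d)) ∘ₗ posFin))
    (-(dividedDifference (fun t => (n : ℝ) * t ^ (n - 1)) M.leftMul M.rightMul M.velocity)) := by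
  induction n with
  | zero =>
    have e := dividedDifference_const_mul (a := M.leftMul) (b := M.rightMul) 0
      (q := fun t : ℝ => t ^ (0 - 1)) (by fun_prop)
    simp only [Nat.cast_zero]
    rw [e, Complex.ofReal_zero, zero_smul, zero_apply, neg_zero]
    refine represents_zero.congr (ae_of_all _ fun ω => ?_)
    ext x
    simp
  | succ n ih =>
    have e := dividedDifference_pow_succ M.isSelfAdjoint_leftMul M.isSelfAdjoint_rightMul
      M.commute_leftMul_rightMul n
    have e2 : -(dividedDifference (fun t => ((n + 1 : ℕ) : ℝ) * t ^ (n + 1 - 1)) M.leftMul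
        M.rightMul M.velocity) = M.leftMul (-(dividedDifference (fun t => (n : ℝ) * t ^ (n - 1))
          M.leftMul M.rightMul M.velocity)) - (M.rightMul ^ n) M.velocity := by
      rw [Nat.cast_add, Nat.cast_one, Nat.add_sub_cancel, e, map_neg, add_apply, neg_add, sub_eq_add_neg]
      rfl
    rw [e2]
    refine (ih.leftMul.sub (M.represents_velocity.rightMul_pow n)).congr ?_
    filter_upwards [M.ae_ham_incl] with ω hω
    refine LinearMap.ext fun φ => ?_
    simp only [LinearMap.sub_apply, LinearMap.smul_apply, LinearMap.comp_apply,
      ContinuousLinearMap.coe_coe, map_smul, hω, map_sub, pow_succ', Module.End.mul_apply]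
    have hcomm : (M.hamFin ω ^ n : Module.End ℂ (Fin2 d)) (M.hamFin ω φ)
      = M.hamFin ω ((M.hamFin ω ^ n : Module.End ℂ (Fin2 d)) φ) := by
      rw [← Module.End.mul_apply, ← pow_succ, pow_succ', Module.End.mul_apply]
    module

open Polynomial in
theorem represents_polynomial_commutator (p : ℝ[X]) : M.Represents
    (fun ω => Complex.I • incl ∘ₗ (posFin ∘ₗ (aeval (M.hamFin ω : Module.End ℂ (Fin2 d)) p)
      - (aeval (M.hamFin ω : Module.End ℂ (Fin2 d)) p) ∘ₗ posFin))
    (-(dividedDifference (fun t => p.derivative.eval t) M.leftMul M.rightMul M.velocity)) := by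
  induction p using Polynomial.induction_on' with
  | add p r hp hr =>
    simp only [derivative_add, eval_add]
    rw [dividedDifference_add (by fun_prop) (by fun_prop), add_apply, neg_add]
    refine (hp.add hr).congr (ae_of_all _ fun ω => ?_)
    refine LinearMap.ext fun φ => ?_
    simp only [LinearMap.sub_apply, LinearMap.smul_apply, LinearMap.comp_apply,
      LinearMap.add_apply, map_add, map_sub]
    module
  | monomial n c =>
    have e : (fun t => (derivative (monomial n c)).eval t)
        = fun t => c * ((n : ℝ) * t ^ (n - 1)) := by
      ext t
      rw [derivative_monomial, eval_monomial]
      ring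
    rw [e, dividedDifference_const_mul _ (by fun_prop), smul_apply, ← smul_neg]
    refine ((M.represents_pow_commutator n).smul c).congr (ae_of_all _ fun ω => ?_)
    refine LinearMap.ext fun φ => ?_
    simp only [aeval_monomial, Algebra.algebraMap_eq_smul_one, smul_mul_assoc, one_mul,
      LinearMap.sub_apply, LinearMap.smul_apply, LinearMap.comp_apply, map_sub,
      ← Complex.coe_smul, map_smul]
    module

end Polynomial
end AndersonModel

/-! ### The commutator of the position with a function of the Hamiltonian -/

theorem norm_functionOf_sub_le {K : Type*} [NormedAddCommGroup K] [InnerProductSpace ℂ K]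
    [CompleteSpace K] {A : K →L[ℂ] K} {f g : ℝ → ℝ} (hf : Continuous f) (hg : Continuous g)
    {R c : ℝ} (hc : 0 ≤ c) (hA : ‖A‖ ≤ R) (h : ∀ t ∈ Set.Icc (-R) R, |f t - g t| ≤ c) :
    ‖functionOf f A - functionOf g A‖ ≤ c := by
  rw [functionOf, functionOf, ← cfc_sub (a := A) f g]
  refine norm_cfc_le hc fun t ht => h t ?_
  have ht' := spectrum_subset_Icc_norm A ht
  exact ⟨(neg_le_neg hA).trans ht'.1, ht'.2.trans hA⟩

theorem exists_derivative_eq (p : Polynomial ℝ) (c : ℝ) :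
    ∃ r : Polynomial ℝ, r.derivative = p ∧ r.eval 0 = c := by
  have h : ∃ r : Polynomial ℝ, r.derivative = p := by
    induction p using Polynomial.induction_on' with
    | add p q hp hq =>
      obtain ⟨r, rfl⟩ := hp
      obtain ⟨s, rfl⟩ := hq
      exact ⟨r + s, Polynomial.derivative_add⟩
    | monomial n a =>
      refine ⟨Polynomial.monomial (n + 1) (a / (n + 1)), ?_⟩
      rw [Polynomial.derivative_monomial, Nat.add_sub_cancel]
      congr 1
      push_cast
      field_simp
  obtain ⟨r, hr⟩ := h
  refine ⟨r + Polynomial.C (c - r.eval 0), ?_, ?_⟩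
  · simp [hr]
  · simp

/-- Uniform approximation of a continuously differentiable function together with its derivative
by polynomials. -/
theorem exists_polynomial_near_with_derivative {f q : ℝ → ℝ} (hq : Continuous q)
    (hf : ∀ t, HasDerivAt f (q t) t) {R ε : ℝ} (hR : 0 ≤ R) (hε : 0 < ε) :
    ∃ p : Polynomial ℝ, (∀ t ∈ Set.Icc (-R) R, |q t - p.derivative.eval t| ≤ ε) ∧
      ∀ t ∈ Set.Icc (-R) R, |f t - p.eval t| ≤ ε * R := by
  obtain ⟨r, hr⟩ := exists_polynomial_near_of_continuousOn (-R) R q hq.continuousOn ε hε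
  obtain ⟨p, rfl, hp⟩ := exists_derivative_eq r (f 0)
  have hd : ∀ t ∈ Set.Icc (-R) R, |q t - p.derivative.eval t| ≤ ε := fun t ht => by
    rw [abs_sub_comm]
    exact (hr t ht).le
  refine ⟨p, hd, fun t ht => ?_⟩
  have h := Convex.norm_image_sub_le_of_norm_hasDerivWithin_le
    (f := fun t => f t - p.eval t) (f' := fun t => q t - p.derivative.eval t)
    (fun s _ => ((hf s).sub (p.hasDerivAt s)).hasDerivWithinAt) hd (convex_Icc (-R) R)
    (x := 0) (y := t) ⟨by linarith, hR⟩ ht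
  rw [hp, sub_self, sub_zero, sub_zero, Real.norm_eq_abs, Real.norm_eq_abs] at h
  exact h.trans (mul_le_mul_of_nonneg_left (abs_le.2 ht) hε.le)

section Position
variable {d : ℕ} [NeZero d]

theorem posOp_of_eq {φ ψ : L2 d} (h : ∀ x : Lattice d, ψ x = ((x 0 : ℤ) : ℂ) * φ x) :
    posOp φ = ψ := by
  have hmem : Memℓp (fun x : Lattice d => ((x 0 : ℤ) : ℂ) * φ x) 2 := by
    have := lp.memℓp ψ
    rwa [show (ψ : Lattice d → ℂ) = fun x => ((x 0 : ℤ) : ℂ) * φ x from funext h] at this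
  rw [posOp, dif_pos hmem]
  ext x
  exact (h x).symm

theorem posOp_delta (a : Lattice d) : posOp (delta a) = ((a 0 : ℤ) : ℂ) • delta a := by
  refine posOp_of_eq fun x => ?_
  rw [lp.coeFn_smul, Pi.smul_apply, smul_eq_mul]
  by_cases hx : x = a
  · rw [hx]
  · rw [delta, lp.single_apply_ne _ _ _ hx, mul_zero, mul_zero]

end Position

namespace AndersonModel
variable {d : ℕ} {Ω : Type*} [MeasurableSpace Ω] {P : Measure Ω} (M : AndersonModel d Ω P)
variable [NeZero d]

/-- The operator `i [X₁, f(H)]` on the finitely supported functions: the linear map which sends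
`δ_a` to `i (X₁ f(H) δ_a - f(H) X₁ δ_a)`. -/
noncomputable def functionVelocityFamily (f : ℝ → ℝ) (ω : Ω) : Fin2 d →ₗ[ℂ] L2 d :=
  Finsupp.linearCombination ℂ fun a =>
    Complex.I • (posOp (functionOf f (M.ham ω) (delta a))
      - functionOf f (M.ham ω) (posOp (delta a)))

/-- An operator whose matrix elements are those of `i [X₁, f(H)]` equals `i [X₁, f(H)]`; in
particular `f(H) δ_a` is then in the domain of `X₁`. -/
theorem functionVelocityFamily_eq {f : ℝ → ℝ} {ω : Ω} {B : Fin2 d →ₗ[ℂ] L2 d}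
    (h : ∀ a x : Lattice d, B (Finsupp.single a 1) x
      = Complex.I * ((((x 0 : ℤ) : ℂ) - ((a 0 : ℤ) : ℂ))
        * functionOf f (M.ham ω) (delta a) x)) :
    B = M.functionVelocityFamily f ω := by
  refine Finsupp.lhom_ext' fun a => LinearMap.ext_ring ?_
  simp only [LinearMap.comp_apply, Finsupp.lsingle_apply, functionVelocityFamily,
    Finsupp.linearCombination_single, one_smul]
  have hpos : posOp (functionOf f (M.ham ω) (delta a))
      = -Complex.I • B (Finsupp.single a 1)
        + ((a 0 : ℤ) : ℂ) • functionOf f (M.ham ω) (delta a) := by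
    refine posOp_of_eq fun x => ?_
    rw [lp.coeFn_add, Pi.add_apply, lp.coeFn_smul, lp.coeFn_smul, Pi.smul_apply, Pi.smul_apply,
      h a x, smul_eq_mul, smul_eq_mul]
    linear_combination (-((x 0 : ℤ) : ℂ) + ((a 0 : ℤ) : ℂ))
      * functionOf f (M.ham ω) (delta a) x * Complex.I_mul_I
  rw [hpos, posOp_delta, map_smul, add_sub_cancel_right, smul_smul, mul_neg, Complex.I_mul_I,
    neg_neg, one_smul]

/-- The commutator formula `i [X₁, f(H)] = D Ẋ₁`, where `D` is the divided difference of `-f` at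
the commuting operators of left and right multiplication by `H`. It is algebra for polynomials,
and the general case follows by approximating `f` and its derivative uniformly by polynomials. -/
theorem represents_functionVelocityFamily [IsFiniteMeasure P] {f q : ℝ → ℝ} (hq : Continuous q)
    (hf : ∀ t, HasDerivAt f (-(q t)) t) :
    M.Represents (M.functionVelocityFamily f)
      (dividedDifference q M.leftMul M.rightMul M.velocity) := by
  have hfc : Continuous f := continuous_iff_continuousAt.2 fun t => (hf t).continuousAt
  obtain ⟨C, hC0, hC⟩ := M.exists_norm_ham_le
  -- The interval `[-R, R]` contains almost surely the spectrum of `H_ω`, and also the real and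
  -- imaginary parts of the spectrum of `ℋ_L + i ℋ_R`.
  set R : ℝ := max C ‖M.leftMul + Complex.I • M.rightMul‖ with hRdef
  have hR : 0 ≤ R := hC0.trans (le_max_left _ _)
  choose p hp hp' using fun n : ℕ => exists_polynomial_near_with_derivative (f := f)
    (q := fun t => -(q t)) hq.neg hf hR (ε := 1 / ((n : ℝ) + 1)) (by positivity)
  have hε : Tendsto (fun n : ℕ => 1 / ((n : ℝ) + 1)) atTop (𝓝 0) :=
    tendsto_one_div_add_atTop_nhds_zero_nat
  have htend : Tendsto (fun n => -(dividedDifference (fun t => (p n).derivative.eval t)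
      M.leftMul M.rightMul M.velocity)) atTop
      (𝓝 (dividedDifference q M.leftMul M.rightMul M.velocity)) := by
    rw [tendsto_iff_norm_sub_tendsto_zero]
    refine squeeze_zero (fun _ => norm_nonneg _) (fun n => ?_)
      (by simpa only [zero_mul] using hε.mul_const ‖M.velocity‖)
    have e : -(dividedDifference (fun t => (p n).derivative.eval t) M.leftMul M.rightMul)
        = dividedDifference (fun t => -1 * (p n).derivative.eval t) M.leftMul M.rightMul := by
      rw [dividedDifference_const_mul _ (by fun_prop)]
      simp
    have h1 := norm_dividedDifference_sub_le (a := M.leftMul) (b := M.rightMul)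
      (q := fun t => -1 * (p n).derivative.eval t) (q' := q) (by fun_prop) hq
      (c := 1 / ((n : ℝ) + 1)) (R := R) (by positivity) (le_max_right _ _) (fun t ht => by
        have := hp n t ht
        rwa [neg_one_mul, abs_sub_comm, sub_neg_eq_add, ← abs_neg, neg_add,
          ← sub_eq_add_neg])
    rw [← neg_apply, e, ← sub_apply]
    exact ContinuousLinearMap.le_of_opNorm_le _ h1 _
  -- Let `F` be any representative of the limit; its matrix elements are limits of those of
  -- `i [X₁, p(H)]` along a subsequence.
  obtain ⟨F, hF⟩ := exists_represents
    (dividedDifference q M.leftMul M.rightMul M.velocity)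
  refine hF.congr ?_
  have hcols : ∀ᵐ ω ∂P, ∀ a x : Lattice d, F ω (Finsupp.single a 1) x
      = Complex.I * ((((x 0 : ℤ) : ℂ) - ((a 0 : ℤ) : ℂ))
        * functionOf f (M.ham ω) (delta a) x) := by
    refine ae_all_iff.2 fun a => ?_
    obtain ⟨ns, hns, hconv⟩ := Represents.exists_subseq_tendsto
      (fun n => M.represents_polynomial_commutator (p n)) hF htend a
    filter_upwards [hconv, hC, M.ae_functionOf_polynomial_incl] with ω h1 h2 h3 x
    have hham : ‖M.ham ω‖ ≤ R :=
      (ContinuousLinearMap.opNorm_le_bound _ hC0 h2).trans (le_max_left _ _)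
    have hnorm : Tendsto (fun n => functionOf (fun t => (p n).eval t) (M.ham ω)) atTop
        (𝓝 (functionOf f (M.ham ω))) := by
      rw [tendsto_iff_norm_sub_tendsto_zero]
      refine squeeze_zero (fun _ => norm_nonneg _) (fun n => ?_)
        (by simpa only [zero_mul] using hε.mul_const R)
      rw [norm_sub_rev]
      exact norm_functionOf_sub_le hfc (by fun_prop) (by positivity) hham (hp' n)
    have heval : Continuous fun ψ : L2 d => ψ x :=
      (lp.evalCLM ℂ (fun _ : Lattice d => ℂ) 2 x).continuous
    have h4 : Tendsto (fun k => functionOf (fun t => (p (ns k)).eval t) (M.ham ω) (delta a) x)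
        atTop (𝓝 (functionOf f (M.ham ω) (delta a) x)) :=
      (heval.tendsto _).comp
        (((ContinuousLinearMap.apply ℂ (L2 d) (delta a)).continuous.tendsto _).comp
          (hnorm.comp hns.tendsto_atTop))
    have h5 := (heval.tendsto _).comp h1
    refine tendsto_nhds_unique h5 (((h4.const_mul _).const_mul _).congr fun k => ?_)
    have hpos : posFin (Finsupp.single a (1 : ℂ))
        = ((a 0 : ℤ) : ℂ) • Finsupp.single a (1 : ℂ) := by
      rw [posFin, mulFin_single, Finsupp.smul_single]
      simp
    have hdel : incl (Finsupp.single a (1 : ℂ)) = delta a := by rw [incl_single, one_smul]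
    simp only [Function.comp_apply, LinearMap.smul_apply, LinearMap.comp_apply,
      LinearMap.sub_apply, map_sub, hpos, map_smul, lp.coeFn_smul, lp.coeFn_sub, Pi.smul_apply,
      Pi.sub_apply, incl_posFin_apply, h3, hdel, smul_eq_mul]
    ring
  filter_upwards [hcols] with ω hω using M.functionVelocityFamily_eq hω

end AndersonModel

/-! ### The conductivity measures -/

section SquareRoot
variable {K : Type*} [NormedAddCommGroup K] [InnerProductSpace ℂ K] [CompleteSpace K]
  {A S : K →L[ℂ] K}

theorem functionOf_sqrt_mul_self {W : K →L[ℂ] K} (hW : 0 ≤ W) :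
    functionOf Real.sqrt (W * W) = W := by
  have hsa : IsSelfAdjoint W := IsSelfAdjoint.of_nonneg hW
  have hQ : 0 ≤ W * W := by
    have := star_mul_self_nonneg W
    rwa [hsa.star_eq] at this
  rw [functionOf, ← cfcₙ_eq_cfc (hf0 := Real.sqrt_zero), ← CFC.sqrt_eq_real_sqrt (W * W) hQ]
  exact CFC.sqrt_unique rfl hW

/-- A self-adjoint `S` which commutes with `A` leaves `ker A` and its orthogonal complement
invariant, so it commutes with the projection onto the latter. -/
theorem commute_starProjection_ker_orthogonal (hS : IsSelfAdjoint S) (h : Commute A S) :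
    Commute A.kerᗮ.starProjection S := by
  have hSsym := ContinuousLinearMap.isSelfAdjoint_iff_isSymmetric.1 hS
  have hker : ∀ x ∈ A.ker, S x ∈ A.ker := by
    intro x hx
    have hx' : A x = 0 := hx
    have : A (S x) = S (A x) := congrArg (fun B : K →L[ℂ] K => B x) h.eq
    change A (S x) = 0
    rw [this, hx', map_zero]
  have horth : ∀ x ∈ A.kerᗮ, S x ∈ A.kerᗮ := by
    intro x hx
    rw [Submodule.mem_orthogonal] at hx ⊢
    intro k hk
    rw [← hx (S k) (hker k hk)]
    exact (hSsym k x).symm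
  refine ContinuousLinearMap.ext fun x => ?_
  refine Submodule.eq_starProjection_of_mem_orthogonal
    (horth _ (Submodule.starProjection_apply_mem _ x)) ?_
  rw [Submodule.orthogonal_orthogonal]
  change S x - S (A.kerᗮ.starProjection x) ∈ A.ker
  rw [← map_sub]
  refine hker _ ?_
  rw [Submodule.starProjection_orthogonal_val, sub_sub_cancel]
  exact Submodule.starProjection_apply_mem _ x

end SquareRoot

theorem isFiniteBorelMeasure_pi_mul {Φ : Set ℝ → ℂ} {m : Measure ℝ} [IsFiniteMeasure m]
    (h : ∀ B, MeasurableSet B → Φ B = Real.pi * ((m.real B : ℝ) : ℂ)) :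
    IsFiniteBorelMeasure Φ := by
  refine ⟨Real.pi.toNNReal • m, inferInstance, fun B hB => ?_⟩
  rw [h B hB, measureReal_nnreal_smul_apply, Real.coe_toNNReal _ Real.pi_pos.le,
    Complex.ofReal_mul]

section Fermi

/-- Minus the derivative of the Fermi function `f_μ^T`. -/
noncomputable def fermiSlope (μ T E : ℝ) : ℝ :=
  Real.exp ((E - μ) / T) / T / (Real.exp ((E - μ) / T) + 1) ^ 2

theorem continuous_fermiSlope (μ T : ℝ) : Continuous (fermiSlope μ T) := by
  unfold fermiSlope
  refine Continuous.div (by fun_prop) (by fun_prop) fun E => ?_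
  positivity

theorem hasDerivAt_fermi (μ T E : ℝ) :
    HasDerivAt (fermi μ T) (-(fermiSlope μ T E)) E := by
  have h1 : HasDerivAt (fun E : ℝ => (E - μ) / T) (1 / T) E :=
    ((hasDerivAt_id E).sub_const μ).div_const T
  have h2 := (h1.exp.add_const 1).inv (by positivity)
  refine h2.congr_deriv ?_
  rw [fermiSlope, mul_one_div, neg_div]

theorem fermiSlope_pos (μ : ℝ) {T : ℝ} (hT : 0 < T) (E : ℝ) : 0 < fermiSlope μ T E := by
  unfold fermiSlope
  positivity

theorem abs_fermiSlope_le (μ : ℝ) {T : ℝ} (hT : 0 < T) (E : ℝ) : |fermiSlope μ T E| ≤ 1 / T := by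
  rw [abs_of_pos (fermiSlope_pos μ hT E), fermiSlope, div_div, div_le_div_iff₀ (by positivity) hT]
  have := Real.exp_pos ((E - μ) / T)
  nlinarith [mul_pos this hT, mul_pos (pow_pos this 2) hT]

end Fermi

namespace AndersonModel
variable {d : ℕ} {Ω : Type*} [MeasurableSpace Ω] {P : Measure Ω} (M : AndersonModel d Ω P)

/-- `ℱ = -ℒ D`, where `D` is the divided difference of minus the Fermi function. -/
theorem fermiCommutator_eq (μ T : ℝ) : M.fermiCommutator μ T
    = -(M.liouvillian * dividedDifference (fermiSlope μ T) M.leftMul M.rightMul) := by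
  have h := sub_mul_dividedDifference M.isSelfAdjoint_leftMul M.isSelfAdjoint_rightMul
    M.commute_leftMul_rightMul (continuous_fermiSlope μ T)
    (F := fun E => -(fermi μ T E))
    (fun t => (hasDerivAt_fermi μ T t).fun_neg.congr_deriv (neg_neg _))
  rw [cfc_neg, cfc_neg] at h
  rw [liouvillian, h, fermiCommutator, functionOf, functionOf]
  abel

/-- `-ℒ_⊥⁻¹ ℱ = (1 - P₀) D`, because `ℱ A = ℒ (-D A)` and `ℒ_⊥⁻¹ ℒ = 1 - P₀`. -/
theorem pseudoInverseComp_eq (μ T : ℝ) : M.pseudoInverseComp μ T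
    = M.liouvillian.kerᗮ.starProjection
      * dividedDifference (fermiSlope μ T) M.leftMul M.rightMul := by
  set D := dividedDifference (fermiSlope μ T) M.leftMul M.rightMul with hD
  have hQ : ∀ A, IsBorelApply M.liouvillian (fun t => t⁻¹) (M.fermiCommutator μ T A)
      (-((M.liouvillian.kerᗮ.starProjection * D) A)) := by
    intro A
    have h := isBorelApply_inv_map_self M.isSelfAdjoint_liouvillian (-(D A))
    rw [← Submodule.starProjection_orthogonal_val, map_neg, map_neg] at h
    rw [fermiCommutator_eq]
    exact h
  have hex : ∃ Q : M.K2 →L[ℂ] M.K2, ∀ A, IsBorelApply M.liouvillian (fun t => t⁻¹)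
      (M.fermiCommutator μ T A) (-(Q A)) := ⟨_, hQ⟩
  rw [pseudoInverseComp, dif_pos hex]
  exact ContinuousLinearMap.ext fun A =>
    neg_injective ((hex.choose_spec A).unique (hQ A))

/-- A multiple of the spectral measures at vectors of square norm `O(1 / T)` tends to zero. -/
theorem tendsto_zero_of_eq_spectralMeasure {Φ : ℝ → ℂ} {c : ℝ} {B : Set ℝ}
    (h : ∀ T, 0 < T → ∃ y : M.K2,
      Φ T = Real.pi * (((spectralMeasure M.liouvillian y).real B : ℝ) : ℂ) ∧
        ‖y‖ ^ 2 ≤ 1 / T * c) : Tendsto Φ atTop (𝓝 0) := by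
  have hlim : Tendsto (fun T : ℝ => Real.pi * (1 / T * c)) atTop (𝓝 0) := by
    have := ((tendsto_inv_atTop_zero (𝕜 := ℝ)).mul_const c).const_mul Real.pi
    simpa only [zero_mul, mul_zero, one_div] using this
  refine squeeze_zero_norm' ?_ hlim
  filter_upwards [eventually_gt_atTop 0] with T hT
  obtain ⟨y, hy, hle⟩ := h T hT
  rw [hy, norm_mul, Complex.norm_real, Complex.norm_real, Real.norm_of_nonneg Real.pi_pos.le,
    Real.norm_of_nonneg measureReal_nonneg]
  refine mul_le_mul_of_nonneg_left (le_trans ?_ hle) Real.pi_pos.le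
  rw [← measureReal_univ_spectralMeasure M.isSelfAdjoint_liouvillian y]
  exact measureReal_mono (Set.subset_univ B)

variable [NeZero d]

theorem fermiVelocity_eq [IsFiniteMeasure P] (μ T : ℝ) : M.fermiVelocity μ T
    = dividedDifference (fermiSlope μ T) M.leftMul M.rightMul M.velocity :=
  (M.represents_functionVelocityFamily (continuous_fermiSlope μ T)
    (hasDerivAt_fermi μ T)).toK2_eq

/-- Both `Σ_μ^T` and `Γ_μ^T` are `π` times spectral measures of the Liouvillian: those of
`y = D^{1/2} Ẋ₁` and of its component `w` orthogonal to the kernel. -/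
theorem exists_conductivity_eq_spectralMeasure [IsProbabilityMeasure P] (μ : ℝ) {T : ℝ}
    (hT : 0 < T) : ∃ y w : M.K2,
      (∀ B, MeasurableSet B → M.conductivity μ T B
        = Real.pi * (((spectralMeasure M.liouvillian y).real B : ℝ) : ℂ)) ∧
      (∀ B, MeasurableSet B → M.conductivityPerp μ T B
        = Real.pi * (((spectralMeasure M.liouvillian w).real B : ℝ) : ℂ)) ∧
      ‖w‖ ≤ ‖y‖ ∧ 0 < ‖w‖ ∧ ‖y‖ ^ 2 ≤ 1 / T * ‖M.velocity‖ ^ 2 := by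
  obtain ⟨S, hS0, hScomm, hSinj, hSS⟩ := exists_sqrt_dividedDifference
    M.isSelfAdjoint_leftMul M.isSelfAdjoint_rightMul M.commute_leftMul_rightMul
    (continuous_fermiSlope μ T) (fermiSlope_pos μ hT)
  have hScomm' : Commute M.liouvillian S := hScomm
  have hSsa : IsSelfAdjoint S := IsSelfAdjoint.of_nonneg hS0
  have hSsym : ∀ x z : M.K2, inner ℂ (S x) z = inner ℂ x (S z) :=
    ContinuousLinearMap.isSelfAdjoint_iff_isSymmetric.1 hSsa
  set E := M.liouvillian.kerᗮ.starProjection with hE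
  have hES : Commute E S := commute_starProjection_ker_orthogonal hSsa hScomm'
  have hEE : E * E = E := Submodule.isIdempotentElem_starProjection _
  have hEsa : IsSelfAdjoint E := isSelfAdjoint_starProjection _
  -- The square root of `-ℒ_⊥⁻¹ ℱ = E S²` is `E S = E S E`.
  have hW0 : 0 ≤ E * S := by
    have h : E * S = E * S * E := by rw [mul_assoc, ← hES.eq, ← mul_assoc, hEE]
    rw [h]
    exact hEsa.conjugate_nonneg hS0
  have hWW : E * S * (E * S) = M.pseudoInverseComp μ T := by
    rw [pseudoInverseComp_eq, ← hSS, ← mul_assoc, mul_assoc E S E, ← hES.eq, ← mul_assoc, hEE,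
      mul_assoc]
  have hroot : M.rootVelocity μ T = E (S M.velocity) := by
    rw [rootVelocity, ← hWW, functionOf_sqrt_mul_self hW0]
    rfl
  have hFV : M.fermiVelocity μ T = S (S M.velocity) := by
    rw [fermiVelocity_eq, ← hSS]
    rfl
  refine ⟨S M.velocity, E (S M.velocity), fun B hB => ?_, fun B hB => ?_,
    Submodule.norm_starProjection_apply_le _ _, ?_, ?_⟩
  · rw [conductivity, hFV, spectralProjection_map_of_commute hScomm' _ hB, ← hSsym,
      inner_spectralProjection _ _ hB]
  · rw [conductivityPerp, hroot, inner_spectralProjection _ _ hB]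
  · rw [norm_pos_iff]
    intro h0
    have h1 : S (E M.velocity) = 0 := by
      rw [← h0]
      exact congrArg (fun B : M.K2 →L[ℂ] M.K2 => B M.velocity) hES.eq.symm
    have h2 : E M.velocity = 0 := hSinj (h1.trans (map_zero S).symm)
    have h3 : M.velocity ∈ M.liouvillian.kerᗮᗮ :=
      (Submodule.starProjection_apply_eq_zero_iff _).1 h2
    rw [Submodule.orthogonal_orthogonal] at h3
    exact M.liouvillian_velocity_ne_zero h3
  · have h1 : ‖S M.velocity‖ ^ 2 = RCLike.re (inner ℂ M.velocity
        (dividedDifference (fermiSlope μ T) M.leftMul M.rightMul M.velocity)) := by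
      rw [← inner_self_eq_norm_sq (𝕜 := ℂ), hSsym, ← hSS]
      rfl
    rw [h1]
    refine (re_inner_le_norm _ _).trans ?_
    have h2 := ContinuousLinearMap.le_of_opNorm_le _
      (norm_dividedDifference_le (a := M.leftMul) (b := M.rightMul) (abs_fermiSlope_le μ hT))
      M.velocity
    calc _ ≤ ‖M.velocity‖ * (1 / T * ‖M.velocity‖) := by gcongr
      _ = _ := by ring

end AndersonModel

end Anderson

open scoped ComplexOrder in
theorem theorem2p1 {d : ℕ} [NeZero d] {Ω : Type*} [MeasurableSpace Ω] (P : Measure Ω)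
    [IsProbabilityMeasure P] (M : Anderson.AndersonModel d Ω P) (μ : ℝ) :
    (∀ T : ℝ, 0 < T →
      Anderson.IsFiniteBorelMeasure (M.conductivity μ T) ∧
      Anderson.IsFiniteBorelMeasure (M.conductivityPerp μ T) ∧
      M.conductivityPerp μ T Set.univ ≤ M.conductivity μ T Set.univ ∧
      0 < M.conductivityPerp μ T Set.univ) ∧
    (∀ B : Set ℝ, MeasurableSet B →
      Tendsto (fun T : ℝ => M.conductivity μ T B) atTop (𝓝 0)) ∧
    (∀ B : Set ℝ, MeasurableSet B →
      Tendsto (fun T : ℝ => M.conductivityPerp μ T B) atTop (𝓝 0)) := by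
  refine ⟨fun T hT => ?_, fun B hB => ?_, fun B hB => ?_⟩
  · obtain ⟨y, w, hy, hw, hle, hpos, -⟩ := M.exists_conductivity_eq_spectralMeasure μ hT
    refine ⟨Anderson.isFiniteBorelMeasure_pi_mul hy, Anderson.isFiniteBorelMeasure_pi_mul hw, ?_⟩
    rw [hy _ MeasurableSet.univ, hw _ MeasurableSet.univ,
      Anderson.measureReal_univ_spectralMeasure M.isSelfAdjoint_liouvillian,
      Anderson.measureReal_univ_spectralMeasure M.isSelfAdjoint_liouvillian,
      ← Complex.ofReal_mul, ← Complex.ofReal_mul]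
    refine ⟨Complex.real_le_real.2 ?_, Complex.zero_lt_real.2 (by positivity)⟩
    gcongr
  · refine M.tendsto_zero_of_eq_spectralMeasure (B := B) (c := ‖M.velocity‖ ^ 2) fun T hT => ?_
    obtain ⟨y, w, hy, -, -, -, hbd⟩ := M.exists_conductivity_eq_spectralMeasure μ hT
    exact ⟨y, hy B hB, hbd⟩
  · refine M.tendsto_zero_of_eq_spectralMeasure (B := B) (c := ‖M.velocity‖ ^ 2) fun T hT => ?_
    obtain ⟨y, w, -, hw, hle, -, hbd⟩ := M.exists_conductivity_eq_spectralMeasure μ hT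
    exact ⟨w, hw B hB, le_trans (by gcongr) hbd⟩
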